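/- Let $G$ be a group. (a) There is a CW-complex $X_G$ of dimension $2$ (it has at least one $2$-cell and no cells of dimension greater than $2$) which is path connected and satisfies $\pi_1(X_G,x)\cong G$ for every base point $x\in X_G$. (b) The complex can be built from any presentation of $G$, as follows. Let $(g_\alpha)_{\alpha\in A}$ be a family of letters and $(r_\beta)_{\beta\in B}$ a family of words in the $g_\alpha$ and their formal inverses such that $G\cong\langle g_\alpha\mid r_\beta\rangle$, i.e. $G$ is isomorphic to the quotient of the free group on $A$ by the normal closure of the elements represented by the $r_\beta$ (every group has such a presentation, and it can be chosen with $B\neq\emptyset$). Let $\bigvee_{\alpha\in A}S^1$ be the wedge of one circle for each generator (a point if $A=\emptyset$). Each word $r_\beta$ defines a loop in the wedge at the wedge point: run, letter by letter, once around the circle of index $\alpha$ in the positive direction for each letter $g_\alpha$ and in the negative direction for each letter $g_\alpha^{-1}$ (the constant loop if the word is empty). Let $$X=\Bigl(\bigvee_{\alpha\in A}S^1\Bigr)\cup\coprod_{\beta\in B}D^2$$ be the space obtained by attaching one disc for each $\beta\in B$ along the loop of $r_\beta$. Then $X$ is a CW-complex with exactly one $0$-cell (the wedge point), with the circles, indexed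 by $A$, as $1$-cells, with the attached discs, indexed by $B$, as $2$-cells, and with no cells of dimension greater than $2$; its $1$-skeleton is the wedge of circles $\bigvee_{\alpha\in A}S^1$. Moreover $X$ is path connected and $\pi_1(X,x)\cong G$ for every base point $x\in X$. -/

import Mathlib

universe u

noncomputable section

open CategoryTheory

/-! ### Cells, characteristic maps and skeleta of a CW-complex -/

namespace TopCat.CWComplex

/-- The index type of the `n`-cells of a CW-complex. -/
def CellIndex {X : TopCat.{u}} (c : TopCat.CWComplex X) (n : ℕ) : Type u :=
  (c.attachCells n (not_isMax n)).ι

/-- The characteristic map `𝔻 n → X` of an `n`-cell. -/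
def charMap {X : TopCat.{u}} (c : TopCat.CWComplex X) (n : ℕ) (k : c.CellIndex n) :
    TopCat.disk.{u} n ⟶ X :=
  HomotopicalAlgebra.RelativeCellComplex.Cells.ι (c := c)
    { j := n, hj := not_isMax n, k := k }

/-- The `n`-skeleton of a CW-complex: the stage reached once the cells of dimension `0, …, n`
have been attached (stage `0` is the empty space). -/
def skel {X : TopCat.{u}} (c : TopCat.CWComplex X) (n : ℕ) : TopCat.{u} :=
  c.F.obj (n + 1)

/-- The inclusion of the `n`-skeleton. -/
def skelIncl {X : TopCat.{u}} (c : TopCat.CWComplex X) (n : ℕ) : c.skel n ⟶ X :=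
  c.incl.app (n + 1)

/-- The CW-complex has dimension exactly `n`: there is an `n`-cell and there are no cells of
higher dimension. -/
def HasDimension {X : TopCat.{u}} (c : TopCat.CWComplex X) (n : ℕ) : Prop :=
  Nonempty (c.CellIndex n) ∧ ∀ m, n < m → IsEmpty (c.CellIndex m)

end TopCat.CWComplex

/-! ### Wedges of circles -/

/-- The relation on `{pt} ⊔ ∐_α S¹` that identifies the base point of each circle with `pt`. -/
inductive CircleWedge.Rel (α : Type u) : Unit ⊕ (Σ _ : α, Circle) → Unit ⊕ (Σ _ : α, Circle) → Prop
  | glue (a : α) : CircleWedge.Rel α (Sum.inr ⟨a, 1⟩) (Sum.inl ())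

/-- The wedge of a family of circles indexed by `α`, with the quotient topology
(a point if `α` is empty). -/
def CircleWedge (α : Type u) : Type u := Quot (CircleWedge.Rel α)

namespace CircleWedge

variable {α : Type u}

instance : TopologicalSpace (CircleWedge α) :=
  inferInstanceAs (TopologicalSpace (Quot (CircleWedge.Rel α)))

/-- The wedge point. -/
def base : CircleWedge α := Quot.mk _ (Sum.inl ())

/-- The inclusion of the circle with index `a`. -/
def circle (a : α) (z : Circle) : CircleWedge α := Quot.mk _ (Sum.inr ⟨a, z⟩)

theorem circle_one (a : α) : circle a 1 = base := Quot.sound (Rel.glue a)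

theorem continuous_circle (a : α) : Continuous (circle a) :=
  continuous_quot_mk.comp (continuous_inr.comp continuous_sigmaMk)

/-- The loop that runs once, counterclockwise, around the circle with index `a`. -/
def loop (a : α) : Path (base : CircleWedge α) base where
  toFun t := circle a (Circle.exp (2 * Real.pi * t))
  continuous_toFun := (continuous_circle a).comp (by fun_prop)
  source' := by simp [circle_one]
  target' := by simp [circle_one]

/-- The loop of a letter: `(a, true)` stands for the generator `a` and `(a, false)` for its
inverse. -/
def letterLoop (x : α × Bool) : Path (base : CircleWedge α) base :=
  if x.2 then loop x.1 else (loop x.1).symm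

/-- The loop of a word: the loops of its letters, run through one after the other. -/
def wordLoop : List (α × Bool) → Path (base : CircleWedge α) base
  | [] => Path.refl base
  | x :: l => (letterLoop x).trans (wordLoop l)

end CircleWedge

/-! ### Presentation complexes -/

/-- The words `w i` in the letters `α ⊔ α⁻¹` are the relators of a presentation, with
generators `α`, of the group `G`. -/
def Presents {α ι : Type u} (w : ι → List (α × Bool)) (G : Type u) [Group G] : Prop :=
  Nonempty (PresentedGroup (Set.range fun i => FreeGroup.mk (w i)) ≃* G)

/-- The closed unit disc in the Euclidean plane. -/
abbrev ClosedDisc : Type := Metric.closedBall (0 : EuclideanSpace ℝ (Fin 2)) 1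

/-- The point `(cos 2πt, sin 2πt)` of the boundary of the disc. -/
def boundaryPoint (t : unitInterval) : ClosedDisc :=
  ⟨!₂[Real.cos (2 * Real.pi * t), Real.sin (2 * Real.pi * t)], by
    simp [EuclideanSpace.norm_eq, Fin.sum_univ_two]⟩

/-- The relation on `(⋁_α S¹) ⊔ ∐_ι D²` that identifies each boundary point
`(cos 2πt, sin 2πt)` of the disc with index `i` with the value at `t` of the loop of `w i`. -/
inductive PresentationComplex.Rel {α ι : Type u} (w : ι → List (α × Bool)) :
    CircleWedge α ⊕ (Σ _ : ι, ClosedDisc) → CircleWedge α ⊕ (Σ _ : ι, ClosedDisc) → Prop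
  | glue (i : ι) (t : unitInterval) : PresentationComplex.Rel w
      (Sum.inr ⟨i, boundaryPoint t⟩) (Sum.inl (CircleWedge.wordLoop (w i) t))

/-- The presentation complex: a wedge of circles, one for each generator, with discs attached
along the relators. -/
def PresentationComplex {α ι : Type u} (w : ι → List (α × Bool)) : Type u :=
  Quot (PresentationComplex.Rel w)

namespace PresentationComplex

variable {α ι : Type u} (w : ι → List (α × Bool))

instance : TopologicalSpace (PresentationComplex w) :=
  inferInstanceAs (TopologicalSpace (Quot (PresentationComplex.Rel w)))

/-- The map from the wedge of circles to the presentation complex. -/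
def ofWedge (x : CircleWedge α) : PresentationComplex w := Quot.mk _ (Sum.inl x)

/-- The map from the disc with index `i` to the presentation complex. -/
def ofDisc (i : ι) (x : ClosedDisc) : PresentationComplex w := Quot.mk _ (Sum.inr ⟨i, x⟩)

/-- The CW-structure `c` on the presentation complex is the expected one: the wedge point is the
only `0`-cell, the `1`-cells are the circles of the wedge, the `2`-cells are the attached discs,
there are no further cells, and the `1`-skeleton is the wedge of circles.
The characteristic map of a `1`-cell is the parametrization `x ↦ exp(πi(x + 1))`,
`-1 ≤ x ≤ 1`, of its circle. -/
def IsStandardCW (c : TopCat.CWComplex (TopCat.of (PresentationComplex w))) : Prop :=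
  Nonempty (c.CellIndex 0 ≃ Unit) ∧
  (∀ k x, c.charMap 0 k x = ofWedge w CircleWedge.base) ∧
  (∃ e₁ : c.CellIndex 1 ≃ α, ∀ k x, c.charMap 1 k x =
    ofWedge w (CircleWedge.circle (e₁ k) (Circle.exp (Real.pi * (x.down.1 0 + 1))))) ∧
  (∃ e₂ : c.CellIndex 2 ≃ ι, ∀ k x, c.charMap 2 k x = ofDisc w (e₂ k) x.down) ∧
  (∀ n, 2 < n → IsEmpty (c.CellIndex n)) ∧
  (∃ h : c.skel 1 ≃ₜ CircleWedge α, ∀ x, c.skelIncl 1 x = ofWedge w (h x))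

end PresentationComplex

end

/-! The fundamental group is computed by a form of van Kampen's theorem stated for maps out of it. A
flat function assigns to each path an element of a group `H`, multiplicatively and invariantly under
homotopy; it amounts to a functor from the fundamental groupoid to `H`. Two local-to-global
principles replace subdivision of paths and homotopies. By `exists_isFlatOn_univ`, a function of
paths that is flat on each set of an open cover agrees on small paths with a globally flat one. By
`IsFlatOn.mem_subgroup_of_cover`, if the twisted values on small paths lie in a subgroup, so do
those on all paths. The first constructs homomorphisms out of the fundamental group, the second
shows generation.

On the wedge, the values on the circles can be prescribed freely (`CircleWedge.exists_isFlatOn`).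
Such a function extends over the discs as soon as it is trivial on the relator loops
(`PresentationComplex.exists_isFlatOn`), and this condition is necessary because a disc is
contractible. With values in the presented group this gives a homomorphism `Ψ` on the fundamental
group. With the tautological flat function, valued in the fundamental group itself, one gets `Φ`
from the presented group. On generators `Ψ ∘ Φ` is the identity, so `Φ` is injective;
`map_loop_mem`, applied to the range of `Φ`, gives surjectivity.

The CW-structure is the filtration empty, point, wedge, complex. Each step is a pushout because maps
out of the quotient spaces have the universal property of attached cells. -/

noncomputable section

open CategoryTheory

/-! ### Flat functions of paths and their local-to-global principles. -/

section FlatFunctions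

open scoped unitInterval Topology

variable {X Y T : Type*} [TopologicalSpace X] [TopologicalSpace Y] [TopologicalSpace T]
  {H : Type*} [Group H]

/-- `f` is a primitive of the function `F` of paths along the map `g`: the value of `F` on the
image of a path is determined by the values of `f` at the two ends of the path. -/
def IsPrimitiveAlong (F : C(I, X) → H) (g : C(T, X)) (f : T → H) : Prop :=
  ∀ p : C(I, T), F (g.comp p) = (f (p 0))⁻¹ * f (p 1)

/-- A function `F` of paths with values in a group is flat on `U` if it has a primitive along
every map of a square to `U`. On paths in `U`, it is then multiplicative and invariant under
homotopies. -/
def IsFlatOn (U : Set X) (F : C(I, X) → H) : Prop :=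
  ∀ K : C(I × I, X), (∀ t, K t ∈ U) → ∃ f, IsPrimitiveAlong F K f

/-- `f` is a local primitive of `F` along `g`. -/
def IsLocalPrimitiveAlong (F : C(I, X) → H) (g : C(T, X)) (f : T → H) : Prop :=
  ∀ z, ∃ N ∈ 𝓝 z, ∀ p : C(I, T), (∀ t, p t ∈ N) → F (g.comp p) = (f (p 0))⁻¹ * f (p 1)

variable {U : Set X} {F G : C(I, X) → H}

theorem IsPrimitiveAlong.comp {g : C(T, X)} {f : T → H} (hf : IsPrimitiveAlong F g f)
    (k : C(Y, T)) : IsPrimitiveAlong F (g.comp k) (f ∘ k) :=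
  fun p => hf (k.comp p)

theorem IsLocalPrimitiveAlong.comp {g : C(T, X)} {f : T → H} (hf : IsLocalPrimitiveAlong F g f)
    (k : C(Y, T)) : IsLocalPrimitiveAlong F (g.comp k) (f ∘ k) := by
  intro z
  obtain ⟨N, hN, h⟩ := hf (k z)
  exact ⟨k ⁻¹' N, k.continuous.continuousAt hN, fun p hp => h (k.comp p) hp⟩

theorem IsPrimitiveAlong.isLocalPrimitiveAlong {g : C(T, X)} {f : T → H}
    (hf : IsPrimitiveAlong F g f) : IsLocalPrimitiveAlong F g f :=
  fun _ => ⟨Set.univ, Filter.univ_mem, fun p _ => hf p⟩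

theorem IsPrimitiveAlong.mul_left {g : C(T, X)} {f : T → H} (hf : IsPrimitiveAlong F g f)
    (c : H) : IsPrimitiveAlong F g (fun t => c * f t) := by
  intro p
  rw [hf p]
  group

theorem IsFlatOn.congr (hF : IsFlatOn U F) (h : ∀ γ : C(I, X), (∀ t, γ t ∈ U) → G γ = F γ) :
    IsFlatOn U G := by
  intro K hK
  obtain ⟨f, hf⟩ := hF K hK
  exact ⟨f, fun p => by rw [h _ fun t => hK _, hf p]⟩

theorem isFlatOn_coboundary (U : Set X) (u : X → H) :
    IsFlatOn U fun γ : C(I, X) => (u (γ 0))⁻¹ * u (γ 1) :=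
  fun K _ => ⟨u ∘ K, fun _ => rfl⟩

theorem IsFlatOn.comp {F : C(I, X) → H} (hF : IsFlatOn Set.univ F) (g : C(Y, X)) :
    IsFlatOn Set.univ fun γ => F (g.comp γ) :=
  fun K _ => hF (g.comp K) fun _ => Set.mem_univ _

theorem IsFlatOn.map_const (hF : IsFlatOn U F) {x : X} (hx : x ∈ U) :
    F (ContinuousMap.const I x) = 1 := by
  obtain ⟨f, hf⟩ := hF (ContinuousMap.const _ x) fun _ => hx
  simpa using hf (ContinuousMap.const I (0, 0))

/-- Both products telescope to the difference of a primitive between the corners `(0, 0)` and `(1,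
1)`. -/
theorem IsFlatOn.square (hF : IsFlatOn U F) (K : C(I × I, X)) (hK : ∀ t, K t ∈ U) :
    F ⟨fun t => K (0, t), by fun_prop⟩ * F ⟨fun s => K (s, 1), by fun_prop⟩ =
      F ⟨fun s => K (s, 0), by fun_prop⟩ * F ⟨fun t => K (1, t), by fun_prop⟩ := by
  obtain ⟨f, hf⟩ := hF K hK
  have h1 := hf ⟨fun t => (0, t), by fun_prop⟩
  have h2 := hf ⟨fun s => (s, 1), by fun_prop⟩
  have h3 := hf ⟨fun s => (s, 0), by fun_prop⟩
  have h4 := hf ⟨fun t => (1, t), by fun_prop⟩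
  simp only [ContinuousMap.comp, ContinuousMap.coe_mk, Function.comp_def] at h1 h2 h3 h4
  rw [h1, h2, h3, h4]
  group

instance contractibleSpace_unitInterval : ContractibleSpace I :=
  (convex_Icc (0 : ℝ) 1).contractibleSpace ⟨0, by simp⟩

/-- A contraction of `Y` gives every point a track to `y₀`, and the inverse of the value of `F` on
the track is a primitive. To see this, contract the path `p`: the resulting square has as sides the
path, the tracks of its two ends and a constant path. -/
theorem IsFlatOn.exists_primitive [ContractibleSpace Y] (hF : IsFlatOn U F) (g : C(Y, X))
    (hg : ∀ y, g y ∈ U) : ∃ f, IsPrimitiveAlong F g f := by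
  obtain ⟨y₀, ⟨h⟩⟩ := id_nullhomotopic Y
  refine ⟨fun y => (F ⟨fun s => g (h (s, y)), by fun_prop⟩)⁻¹, fun p => ?_⟩
  have hs := hF.square ⟨fun t => g (h (t.1, p t.2)), by fun_prop⟩ fun t => hg _
  have hc : F ⟨fun _ => g (h (1, p 0)), by fun_prop⟩ = 1 := hF.map_const (hg _)
  simp only [ContinuousMap.coe_mk, h.apply_zero, h.apply_one, ContinuousMap.const_apply,
    ContinuousMap.id_apply] at hs hc
  rw [hc, mul_one] at hs
  rw [inv_inv, ← hs, mul_inv_cancel_right]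
  rfl

/-- Inside a small ball any point is joined to the centre by a segment, so `φ` is locally constant,
and the interval is connected. -/
theorem eq_of_locally_path_const {Q : Type*} (φ : I → Q)
    (h : ∀ z, ∃ N ∈ 𝓝 z, ∀ p : C(I, I), (∀ t, p t ∈ N) → φ (p 0) = φ (p 1)) (s t : I) :
    φ s = φ t := by
  have hlc : IsLocallyConstant φ := by
    rw [IsLocallyConstant.iff_eventually_eq]
    intro z
    obtain ⟨N, hN, hp⟩ := h z
    obtain ⟨ε, hε, hb⟩ := Metric.mem_nhds_iff.1 hN
    filter_upwards [Metric.ball_mem_nhds z hε] with y hy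
    have hcont : Continuous fun s : I => (1 - (s : ℝ)) * y + s * z := by fun_prop
    -- The segment from `y` to `z` stays in the interval; `projIcc` only serves to give it the right
    -- codomain.
    have key := hp ⟨fun s => Set.projIcc (0 : ℝ) 1 zero_le_one ((1 - (s : ℝ)) * y + s * z),
      continuous_projIcc.comp hcont⟩ fun s => hb ?_
    · simpa using key
    · have hmem : (1 - (s : ℝ)) * y + s * z ∈ Set.Icc (0 : ℝ) 1 := by
        have := (convex_Icc (0 : ℝ) 1) y.2 z.2 (sub_nonneg.2 s.2.2) s.2.1 (by ring)
        simpa using this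
      rw [ContinuousMap.coe_mk, Set.projIcc_of_mem _ hmem, Metric.mem_ball, Subtype.dist_eq,
        Real.dist_eq]
      have hy' : |(y : ℝ) - z| < ε := hy
      calc |(1 - (s : ℝ)) * y + s * z - z| = (1 - s) * |(y : ℝ) - z| := by
            rw [← abs_of_nonneg (sub_nonneg.2 s.2.2), ← abs_mul,
              abs_of_nonneg (sub_nonneg.2 s.2.2)]
            ring_nf
        _ ≤ 1 * |(y : ℝ) - z| := by
            gcongr
            linarith [s.2.1]
        _ < ε := by rwa [one_mul]
  exact hlc.apply_eq_of_isPreconnected isPreconnected_univ (Set.mem_univ _) (Set.mem_univ _)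

/-- Two local primitives along a path differ by left multiplication by `f' * f⁻¹`, which is locally
constant. The increment is therefore intrinsic and can be used to define a global function. -/
theorem IsLocalPrimitiveAlong.inv_mul_eq {γ : C(I, X)} {f f' : I → H}
    (hf : IsLocalPrimitiveAlong F γ f) (hf' : IsLocalPrimitiveAlong F γ f') :
    (f 0)⁻¹ * f 1 = (f' 0)⁻¹ * f' 1 := by
  have := eq_of_locally_path_const (fun t => f' t * (f t)⁻¹) (fun z => by
    obtain ⟨N, hN, h⟩ := hf z
    obtain ⟨N', hN', h'⟩ := hf' z
    refine ⟨N ∩ N', Filter.inter_mem hN hN', fun p hp => ?_⟩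
    have e := (h p fun t => (hp t).1).symm.trans (h' p fun t => (hp t).2)
    rw [inv_mul_eq_iff_eq_mul] at e
    rw [e]
    group) 0 1
  have h2 : f' 1 = f' 0 * (f 0)⁻¹ * f 1 := by rw [this]; group
  rw [h2]; group

/-- The primitive at `q` is the product of the cocycle over `n` equal steps on the ray from `0` to
`q`. Rays to nearby points are compared on a ladder whose rungs join points at equal height. -/
theorem exists_primitive_of_cocycle {E : Type*} [SeminormedAddCommGroup E] [NormedSpace ℝ E]
    (c : E → E → H) {δ : ℝ} (hδ : 0 < δ)
    (hc : ∀ p q r, dist p q < δ → dist q r < δ → dist p r < δ → c p q * c q r = c p r) :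
    ∃ f : E → H, ∀ p q, ‖p‖ ≤ 1 → ‖q‖ ≤ 1 → dist p q < δ / 2 → c p q = (f p)⁻¹ * f q := by
  -- With more than `2 / δ` steps, each step on a ray to a point of the unit ball is shorter than `δ
  -- / 2`, so the diagonals of the ladder are shorter than `δ`.
  obtain ⟨n, hn⟩ := exists_nat_gt (2 / δ)
  have hn0 : (0 : ℝ) < n := lt_trans (by positivity) hn
  let P : E → ℕ → H := fun q m => Nat.rec 1
    (fun m h => h * c ((m / n : ℝ) • q) (((m + 1 : ℕ) / n : ℝ) • q)) m
  have hP : ∀ q m, P q (m + 1) = P q m * c ((m / n : ℝ) • q) (((m + 1 : ℕ) / n : ℝ) • q) :=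
    fun _ _ => rfl
  have h0 : c 0 0 = 1 := by
    have := hc 0 0 0 (by simpa) (by simpa) (by simpa)
    simpa using this
  have hstep : ∀ (q : E) (m : ℕ), ‖q‖ ≤ 1 →
      dist ((m / n : ℝ) • q) (((m + 1 : ℕ) / n : ℝ) • q) < δ / 2 := by
    intro q m hq
    rw [dist_eq_norm, ← sub_smul, norm_smul]
    have : (m / n : ℝ) - ((m + 1 : ℕ) / n : ℝ) = -(1 / n) := by push_cast; ring
    rw [this, norm_neg, Real.norm_of_nonneg (by positivity)]
    calc 1 / (n : ℝ) * ‖q‖ ≤ 1 / n * 1 := by gcongr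
      _ < δ / 2 := by
        rw [mul_one, div_lt_iff₀ hn0]
        rw [div_lt_iff₀ hδ] at hn
        linarith
  have hclose : ∀ (p q : E) (m : ℕ), m ≤ n → dist p q < δ / 2 →
      dist ((m / n : ℝ) • p) ((m / n : ℝ) • q) < δ / 2 := by
    intro p q m hm h
    have hmn : (m / n : ℝ) ≤ 1 := (div_le_one hn0).2 (by exact_mod_cast hm)
    rw [dist_smul₀, Real.norm_of_nonneg (by positivity)]
    calc (m / n : ℝ) * dist p q ≤ 1 * dist p q := by gcongr
      _ < δ / 2 := by rwa [one_mul]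
  have key : ∀ (p q : E), ‖p‖ ≤ 1 → ‖q‖ ≤ 1 → dist p q < δ / 2 → ∀ m ≤ n,
      P p m * c ((m / n : ℝ) • p) ((m / n : ℝ) • q) = P q m := by
    intro p q hp hq hpq m
    induction m with
    | zero => intro _; simp [P, h0]
    | succ m ih =>
      intro hm
      have ih := ih (by omega)
      have a1 := hstep p m hp
      have a2 := hstep q m hq
      have a3 := hclose p q m (by omega) hpq
      have a4 := hclose p q (m + 1) hm hpq
      have a5 := dist_triangle ((m / n : ℝ) • p) ((m / n : ℝ) • q) (((m + 1 : ℕ) / n : ℝ) • q)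
      -- The cocycle identity on the two triangles of one cell of the ladder, which share the
      -- diagonal from `p` at height `m` to `q` at height `m + 1`.
      rw [hP, hP, mul_assoc, hc _ _ _ (by linarith) (by linarith) (by linarith),
        ← hc ((m / n : ℝ) • p) ((m / n : ℝ) • q) _ (by linarith) (by linarith) (by linarith),
        ← mul_assoc, ih]
  refine ⟨fun q => P q n, fun p q hp hq hpq => ?_⟩
  have := key p q hp hq hpq n le_rfl
  rw [div_self hn0.ne', one_smul, one_smul] at this
  exact eq_inv_mul_iff_mul_eq.2 this

/-- The projection of the plane to the square. -/
def planeToSquare : C(ℝ × ℝ, I × I) :=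
  ⟨fun z => (Set.projIcc 0 1 zero_le_one z.1, Set.projIcc 0 1 zero_le_one z.2),
    (continuous_projIcc.comp continuous_fst).prodMk (continuous_projIcc.comp continuous_snd)⟩

/-- The inclusion of the square in the plane. -/
def squareToPlane : C(I × I, ℝ × ℝ) := ⟨fun z => (z.1, z.2), by fun_prop⟩

theorem planeToSquare_squareToPlane (z : I × I) : planeToSquare (squareToPlane z) = z := by
  simp [planeToSquare, squareToPlane]

theorem dist_planeToSquare_le (z z' : ℝ × ℝ) :
    dist (planeToSquare z) (planeToSquare z') ≤ dist z z' := by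
  have h : ∀ a b : ℝ, dist (Set.projIcc (0 : ℝ) 1 zero_le_one a)
      (Set.projIcc (0 : ℝ) 1 zero_le_one b) ≤ dist a b := fun a b => by
    simpa using (LipschitzWith.projIcc zero_le_one).dist_le_mul a b
  exact max_le_max (h _ _) (h _ _)

/-- The straight path between two points of a real vector space. -/
def segmentPath {E : Type*} [NormedAddCommGroup E] [NormedSpace ℝ E] (p q : E) : C(I, E) :=
  ⟨fun t => AffineMap.lineMap p q (t : ℝ), by fun_prop⟩

/-- Let `δ` be a Lebesgue number of the pulled back cover. Every ball of radius `δ` goes into one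
set of the cover, and being contractible it carries a primitive. Hence the values of `G` on short
segments form a cocycle, whose primitive is the one sought. Extending `K` to the plane by projection
puts balls, segments and rays in a vector space. -/
theorem exists_isLocalPrimitiveAlong_square {ι : Type*} {V : ι → Set X}
    (hV : ∀ i, IsOpen (V i)) (hcov : ∀ x, ∃ i, x ∈ V i) (hG : ∀ i, IsFlatOn (V i) G)
    (K : C(I × I, X)) : ∃ f, IsLocalPrimitiveAlong G K f := by
  obtain ⟨δ, hδ, hleb⟩ := lebesgue_number_lemma_of_metric (s := (Set.univ : Set (I × I)))
    isCompact_univ (c := fun i => K ⁻¹' V i) (fun i => (hV i).preimage K.continuous)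
    (fun z _ => Set.mem_iUnion.2 (hcov (K z)))
  let K' : C(ℝ × ℝ, X) := K.comp planeToSquare
  have hloc : ∀ z : ℝ × ℝ, ∃ f : ℝ × ℝ → H, ∀ p : C(I, ℝ × ℝ), (∀ t, p t ∈ Metric.ball z δ) →
      G (K'.comp p) = (f (p 0))⁻¹ * f (p 1) := by
    intro z
    obtain ⟨i, hi⟩ := hleb (planeToSquare z) (Set.mem_univ _)
    have : ContractibleSpace (Metric.ball z δ) :=
      (convex_ball z δ).contractibleSpace ⟨z, Metric.mem_ball_self hδ⟩
    obtain ⟨f, hf⟩ := (hG i).exists_primitive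
      (K'.comp ⟨((↑) : Metric.ball z δ → ℝ × ℝ), by fun_prop⟩)
      (fun y => hi (lt_of_le_of_lt (dist_planeToSquare_le _ _) y.2))
    classical
    refine ⟨fun y => if h : y ∈ Metric.ball z δ then f ⟨y, h⟩ else 1, fun p hp => ?_⟩
    have := hf ⟨fun t => ⟨p t, hp t⟩, by fun_prop⟩
    simp only [dif_pos (hp 0), dif_pos (hp 1)]
    exact this
  have hseg : ∀ (z p q : ℝ × ℝ), p ∈ Metric.ball z δ → q ∈ Metric.ball z δ → ∀ t,
      segmentPath p q t ∈ Metric.ball z δ := fun z p q hp hq t =>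
    (convex_ball z δ).segment_subset hp hq
      (segment_eq_image_lineMap ℝ p q ▸ ⟨(t : ℝ), t.2, rfl⟩)
  obtain ⟨f, hf⟩ := exists_primitive_of_cocycle (fun p q => G (K'.comp (segmentPath p q))) hδ (by
    intro p q r hpq hqr hpr
    obtain ⟨f, hf⟩ := hloc p
    have hp : p ∈ Metric.ball p δ := Metric.mem_ball_self hδ
    rw [dist_comm] at hpq hpr
    rw [hf _ (hseg p p q hp hpq), hf _ (hseg p q r hpq hpr), hf _ (hseg p p r hp hpr)]
    simp [segmentPath])
  -- Radius `δ / 4` keeps the two ends of a path within `δ / 2` of each other. The path may then be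
  -- replaced by the segment between its ends, since both lie in a ball with a primitive.
  refine ⟨f ∘ squareToPlane, fun z => ⟨squareToPlane ⁻¹' Metric.ball (squareToPlane z) (δ / 4),
    squareToPlane.continuous.continuousAt (Metric.ball_mem_nhds _ (by positivity)),
    fun p hp => ?_⟩⟩
  obtain ⟨g, hg⟩ := hloc (squareToPlane z)
  have hsub : ∀ t, squareToPlane (p t) ∈ Metric.ball (squareToPlane z) δ :=
    fun t => Metric.ball_subset_ball (by linarith) (hp t)
  have hnorm : ∀ y : I × I, ‖squareToPlane y‖ ≤ 1 := fun y => by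
    refine norm_prod_le_iff.2 ⟨?_, ?_⟩
    · exact (Real.norm_of_nonneg y.1.2.1).trans_le y.1.2.2
    · exact (Real.norm_of_nonneg y.2.2.1).trans_le y.2.2.2
  have h0 : dist (squareToPlane (p 0)) (squareToPlane z) < δ / 4 := hp 0
  have h1 : dist (squareToPlane (p 1)) (squareToPlane z) < δ / 4 := hp 1
  have hd := dist_triangle_right (squareToPlane (p 0)) (squareToPlane (p 1)) (squareToPlane z)
  have e1 := hg (squareToPlane.comp p) hsub
  have e2 := hg _ (hseg _ _ _ (hsub 0) (hsub 1))
  have e3 := hf _ _ (hnorm (p 0)) (hnorm (p 1)) (by linarith)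
  have e4 : K'.comp (squareToPlane.comp p) = K.comp p := by
    ext t
    simp [K', planeToSquare_squareToPlane]
  rw [← e4, e1, Function.comp, Function.comp, ← e3, e2]
  simp [segmentPath]

/-- A function of paths that is flat on each set of an open cover agrees on small paths with a
function that is flat everywhere. -/
theorem exists_isFlatOn_univ {ι : Type*} {V : ι → Set X} (hV : ∀ i, IsOpen (V i))
    (hcov : ∀ x, ∃ i, x ∈ V i) (hG : ∀ i, IsFlatOn (V i) G) :
    ∃ F : C(I, X) → H, IsFlatOn Set.univ F ∧
      ∀ i (γ : C(I, X)), (∀ t, γ t ∈ V i) → F γ = G γ := by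
  have hpath : ∀ γ : C(I, X), ∃ f, IsLocalPrimitiveAlong G γ f := fun γ => by
    obtain ⟨f, hf⟩ := exists_isLocalPrimitiveAlong_square hV hcov hG (γ.comp ContinuousMap.fst)
    exact ⟨_, hf.comp ⟨fun t => (t, 0), by fun_prop⟩⟩
  choose f hf using hpath
  -- The value on `γ` is the increment of any local primitive along `γ`.
  refine ⟨fun γ => (f γ 0)⁻¹ * f γ 1, fun K _ => ?_, fun i γ hγ => ?_⟩
  · obtain ⟨k, hk⟩ := exists_isLocalPrimitiveAlong_square hV hcov hG K
    exact ⟨k, fun p => (hf (K.comp p)).inv_mul_eq (hk.comp p)⟩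
  · obtain ⟨k, hk⟩ := hG i (γ.comp ContinuousMap.fst) fun t => hγ t.1
    have hk' := hk.comp (Y := I) ⟨fun t => (t, 0), by fun_prop⟩
    exact ((hf γ).inv_mul_eq hk'.isLocalPrimitiveAlong).trans (hk' (ContinuousMap.id I)).symm

/-- If the values of a flat function, twisted by `u`, lie in a subgroup for all small paths, then
they do so for all paths. -/
theorem IsFlatOn.mem_subgroup_of_cover {ι : Type*} {V : ι → Set X} (hV : ∀ i, IsOpen (V i))
    (hcov : ∀ x, ∃ i, x ∈ V i) (hF : IsFlatOn Set.univ F) (S : Subgroup H) (u : X → H)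
    (h : ∀ i (γ : C(I, X)), (∀ t, γ t ∈ V i) → u (γ 0) * F γ * (u (γ 1))⁻¹ ∈ S)
    (γ : C(I, X)) : u (γ 0) * F γ * (u (γ 1))⁻¹ ∈ S := by
  obtain ⟨f, hf⟩ := hF.exists_primitive γ fun _ => Set.mem_univ _
  -- The hypothesis on small paths says that the left coset of `f t * (u (γ t))⁻¹` modulo `S` is
  -- locally constant.
  have key := eq_of_locally_path_const
    (fun t => ((f t * (u (γ t))⁻¹ : H) : H ⧸ S)) (fun z => by
      obtain ⟨i, hi⟩ := hcov (γ z)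
      refine ⟨γ ⁻¹' V i, γ.continuous.continuousAt ((hV i).mem_nhds hi), fun p hp => ?_⟩
      have := h i (γ.comp p) hp
      rw [hf p] at this
      rw [QuotientGroup.eq]
      simpa [mul_assoc] using this) 0 1
  rw [QuotientGroup.eq] at key
  have e := hf (ContinuousMap.id I)
  rw [ContinuousMap.comp_id] at e
  rw [e]
  simpa [mul_assoc] using key

theorem IsFlatOn.map_trans (hF : IsFlatOn Set.univ F) {x y z : X} (γ : Path x y)
    (γ' : Path y z) : F (γ.trans γ') = F γ * F γ' := by
  obtain ⟨f, hf⟩ := hF.exists_primitive (γ.trans γ' : C(I, X)) fun _ => Set.mem_univ _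
  have e := hf (ContinuousMap.id I)
  let p : C(I, I) := ⟨fun t : I => ⟨(t : ℝ) / 2, by
    constructor <;> linarith [t.2.1, t.2.2]⟩, by fun_prop⟩
  let q : C(I, I) := ⟨fun t : I => ⟨((t : ℝ) + 1) / 2, by
    constructor <;> linarith [t.2.1, t.2.2]⟩, by fun_prop⟩
  have e1 := hf p
  have e2 := hf q
  have c1 : (γ.trans γ' : C(I, X)).comp p = γ := by
    ext t
    have : (t : ℝ) / 2 ≤ 1 / 2 := by linarith [t.2.2]
    simp only [ContinuousMap.comp_apply, ContinuousMap.coe_mk, p,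
      Path.trans_apply, this, dite_true]
    congr 1
    ext
    simp
    ring
  have c2 : (γ.trans γ' : C(I, X)).comp q = γ' := by
    ext t
    by_cases ht : (t : ℝ) = 0
    · have ht' : t = 0 := Subtype.ext ht
      subst ht'
      simp [q, Path.trans_apply]
    · have : ¬ ((t : ℝ) + 1) / 2 ≤ 1 / 2 := by
        have := lt_of_le_of_ne t.2.1 (Ne.symm ht)
        linarith
      simp only [ContinuousMap.comp_apply, ContinuousMap.coe_mk, q,
        Path.trans_apply, this, dite_false]
      congr 1
      ext
      simp
      ring
  rw [ContinuousMap.comp_id] at e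
  rw [c1] at e1
  rw [c2] at e2
  rw [e, e1, e2]
  simp [p, q, mul_assoc]

theorem IsFlatOn.map_refl (hF : IsFlatOn Set.univ F) (x : X) : F (Path.refl x) = 1 :=
  hF.map_const (Set.mem_univ x)

theorem IsFlatOn.map_symm (hF : IsFlatOn Set.univ F) {x y : X} (γ : Path x y) :
    F γ.symm = (F γ)⁻¹ := by
  obtain ⟨f, hf⟩ := hF.exists_primitive (γ : C(I, X)) fun _ => Set.mem_univ _
  have e := hf (ContinuousMap.id I)
  have e1 : F γ.symm = _ := hf ⟨unitInterval.symm, by fun_prop⟩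
  rw [ContinuousMap.comp_id] at e
  rw [e, e1]
  simp

/-- In the square of the homotopy, the sides traced by the end points are constant paths. -/
theorem IsFlatOn.map_eq_of_homotopic (hF : IsFlatOn Set.univ F) {x y : X} {γ γ' : Path x y}
    (h : γ.Homotopic γ') : F γ = F γ' := by
  obtain ⟨h⟩ := h
  have hs := hF.square (h.toContinuousMap) fun _ => Set.mem_univ _
  have h0 : F ⟨fun s => h.toContinuousMap (s, 0), by fun_prop⟩ = 1 := by
    rw [← hF.map_refl x]
    congr 1
    ext
    simp
  have h1 : F ⟨fun s => h.toContinuousMap (s, 1), by fun_prop⟩ = 1 := by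
    rw [← hF.map_refl y]
    congr 1
    ext
    simp
  rw [h0, h1, one_mul, mul_one] at hs
  convert hs using 2
  · ext t; simp
  · ext t; simp

/-- The homomorphism on the fundamental group defined by a flat function. -/
def IsFlatOn.fundamentalGroupHom (hF : IsFlatOn Set.univ F) (x : X) :
    FundamentalGroup X x →* H where
  -- The product in `FundamentalGroup` concatenates in the opposite order; the inverse turns the
  -- resulting antihomomorphism into a homomorphism.
  toFun g := Quotient.lift (fun γ : Path x x => (F γ)⁻¹)
    (fun _ _ h => congrArg _ (hF.map_eq_of_homotopic h)) g.toPath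
  map_one' := inv_eq_one.2 (hF.map_refl x)
  map_mul' g g' := by
    induction g using Quotient.inductionOn with | _ γ =>
    induction g' using Quotient.inductionOn with | _ γ' =>
    exact (congrArg _ (hF.map_trans γ' γ)).trans (mul_inv_rev _ _)

end FlatFunctions

/-! ### The tautological flat function, deformations, and lifts of paths. -/

section FlatFunctions

open scoped unitInterval Topology

variable {X : Type*} [TopologicalSpace X] {H : Type*} [Group H]

/-- On a path connected space, there is a flat function with values in the fundamental group whose
value on a loop at the base point is the inverse of its class. -/
theorem exists_isFlatOn_fundamentalGroup [PathConnectedSpace X] (x : X) :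
    ∃ F : C(I, X) → FundamentalGroup X x, IsFlatOn Set.univ F ∧
      ∀ γ : Path x x, F γ = (FundamentalGroup.fromPath (Path.Homotopic.Quotient.mk γ))⁻¹ := by
  classical
  -- Chosen path classes from `x` close up every path to a loop; the constant choice at `x` leaves
  -- loops at `x` unchanged.
  have hC : ∃ C : ∀ y : X, Path.Homotopic.Quotient x y, C x = .refl x := by
    refine ⟨Function.update (fun y => .mk (PathConnectedSpace.somePath x y)) x (.refl x), ?_⟩
    simp
  obtain ⟨C, hC⟩ := hC
  let E : C(I, X) → FundamentalGroup X x := fun γ =>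
    (C (γ 0)).trans ((Path.Homotopic.Quotient.mk ⟨γ, rfl, rfl⟩).trans (C (γ 1)).symm)
  have hE : ∀ (y z : X) (γ : Path y z),
      E γ = (C y).trans ((Path.Homotopic.Quotient.mk γ).trans (C z).symm) := by
    intro y z γ
    obtain ⟨γ, rfl, rfl⟩ := γ
    rfl
  refine ⟨fun γ => (E γ)⁻¹, fun K _ => ?_, fun γ => ?_⟩
  · let B : ∀ t : I × I, Path (0 : I × I) t := fun t => PathConnectedSpace.somePath _ _
    refine ⟨fun t => (E ((B t).map K.continuous))⁻¹, fun p => ?_⟩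
    -- The square is simply connected, so the chosen path to `p 0` followed by `p` is homotopic to
    -- the chosen path to `p 1`.
    have key : E (K.comp p) * E ((B (p 0)).map K.continuous) =
        E ((B (p 1)).map K.continuous) := by
      have hp : Path.Homotopic.Quotient.mk (((B (p 0)).trans ⟨p, rfl, rfl⟩).map K.continuous) =
          Path.Homotopic.Quotient.mk ((B (p 1)).map K.continuous) :=
        Quotient.sound ((SimplyConnectedSpace.paths_homotopic _ _).map K)
      rw [Path.map_trans, Path.Homotopic.Quotient.mk_trans] at hp
      rw [show E (K.comp p) = _ from
          hE _ _ ((⟨p, rfl, rfl⟩ : Path (p 0) (p 1)).map K.continuous),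
        hE, hE, ← hp, FundamentalGroup.mul_def]
      simp only [Path.Homotopic.Quotient.trans_assoc]
      congr 2
      rw [← Path.Homotopic.Quotient.trans_assoc, Path.Homotopic.Quotient.symm_trans,
        Path.Homotopic.Quotient.refl_trans]
    dsimp only
    rw [inv_inv, ← key, mul_inv_rev, mul_inv_cancel_left]
  · dsimp only
    rw [hE, hC]
    congr 1
    rw [Path.Homotopic.Quotient.refl_trans]
    exact Path.Homotopic.Quotient.trans_refl _

/-- A deformation of the space changes the value of a flat function on a path by its values on the
tracks of the end points. -/
theorem IsFlatOn.map_eq_of_deformation {F : C(I, X) → H} (hF : IsFlatOn Set.univ F)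
    (D : C(X, C(I, X))) (hD : ∀ x, D x 0 = x) (γ : C(I, X)) :
    F γ = F (D (γ 0)) * F ⟨fun t => D (γ t) 1, by fun_prop⟩ * (F (D (γ 1)))⁻¹ := by
  have h := hF.square ⟨fun t => D (γ t.2) t.1, by fun_prop⟩ fun _ => Set.mem_univ _
  simp only [ContinuousMap.coe_mk, hD] at h
  exact eq_mul_inv_of_mul_eq h

/-- A path in the image of an embedded disjoint union lifts to one of the pieces. -/
theorem exists_lift_of_isEmbedding_sigma {ι : Type*} {B : ι → Type*}
    [∀ i, TopologicalSpace (B i)] {j : (Σ i, B i) → X} (hj : Topology.IsEmbedding j) (γ : C(I, X))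
    (hγ : ∀ t, γ t ∈ Set.range j) : ∃ i, ∃ g : C(I, B i), ∀ t, γ t = j ⟨i, g t⟩ := by
  choose k hk using hγ
  have hkc : Continuous k := by
    rw [hj.continuous_iff]
    exact γ.continuous.congr fun t => (hk t).symm
  obtain ⟨i, g, hg, h⟩ := hkc.exists_lift_sigma
  exact ⟨i, ⟨g, hg⟩, fun t => by rw [← hk t, h]; rfl⟩

/-- By the intermediate value theorem. It keeps a path in the right half circle that avoids `1` on
one side of the real axis. -/
theorem nonneg_iff_of_ne_zero {f : I → ℝ} (hf : Continuous f) (h : ∀ t, f t ≠ 0) (s t : I) :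
    0 ≤ f s ↔ 0 ≤ f t := by
  by_contra hne
  have : (0 : ℝ) ∈ Set.range f := by
    by_cases hs : 0 ≤ f s
    · exact mem_range_of_exists_le_of_exists_ge hf ⟨t, by_contra fun h' => hne (by
        simp [hs, (not_le.1 h').le])⟩ ⟨s, hs⟩
    · exact mem_range_of_exists_le_of_exists_ge hf ⟨s, (not_le.1 hs).le⟩
        ⟨t, by_contra fun h' => hne (by simp [hs, h'])⟩
  obtain ⟨r, hr⟩ := this
  exact h r hr

end FlatFunctions

/-! ### Parametrization and contraction of the circle. -/

section CircleLemmas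

/-- The unique `t` with `0 < t ≤ 1` and `exp (2πit) = z`. -/
def Circle.param (z : Circle) : ℝ := (Complex.arg (-(z : ℂ)) + Real.pi) / (2 * Real.pi)

theorem Circle.param_pos (z : Circle) : 0 < z.param :=
  div_pos (by linarith [Complex.neg_pi_lt_arg (-(z : ℂ))]) Real.two_pi_pos

theorem Circle.param_le_one (z : Circle) : z.param ≤ 1 := by
  rw [Circle.param, div_le_one Real.two_pi_pos]
  linarith [Complex.arg_le_pi (-(z : ℂ))]

theorem Circle.param_one : (1 : Circle).param = 1 := by
  have := Real.pi_pos
  rw [Circle.param, Circle.coe_one, Complex.arg_neg_one]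
  field_simp
  norm_num

theorem Circle.exp_param (z : Circle) : Circle.exp (2 * Real.pi * z.param) = z := by
  have := Real.pi_pos
  have h : 2 * Real.pi * z.param = Complex.arg (-(z : ℂ)) + Real.pi := by
    rw [Circle.param]
    field_simp
  ext
  rw [h, Circle.coe_exp]
  push_cast
  rw [add_mul, Complex.exp_add, Complex.exp_pi_mul_I]
  have h2 := Complex.norm_mul_exp_arg_mul_I (-(z : ℂ))
  rw [norm_neg, Circle.norm_coe, Complex.ofReal_one, one_mul] at h2
  rw [h2]
  ring

theorem Circle.eq_one_of_im_eq_zero {z : Circle} (him : (z : ℂ).im = 0) (hre : 0 ≤ (z : ℂ).re) :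
    z = 1 := by
  have h := z.normSq_coe
  rw [Complex.normSq_apply, him] at h
  ext
  apply Complex.ext
  · rw [Circle.coe_one, Complex.one_re]
    nlinarith
  · simpa using him

/-- The branch cut of `arg (-z)` meets the circle only at `z = 1`. -/
theorem Circle.continuousAt_param {z : Circle} (hz : z ≠ 1) : ContinuousAt Circle.param z := by
  have h : -(z : ℂ) ∈ Complex.slitPlane := by
    rw [Complex.mem_slitPlane_iff]
    by_contra! hcon
    refine hz (Circle.eq_one_of_im_eq_zero ?_ ?_)
    · simpa using hcon.2
    · simpa using hcon.1
  exact ((Complex.continuousAt_arg h).comp (f := fun z : Circle => -(z : ℂ))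
    (by fun_prop)).add_const _ |>.div_const _

/-- A deformation of the circle, fixing `1`, that contracts the open right half to `1`. -/
def Circle.contract (z : Circle) (s : ℝ) : Circle :=
  z * Circle.exp (-(s * Real.arcsin (z : ℂ).im))

theorem Circle.contract_zero (z : Circle) : z.contract 0 = z := by simp [Circle.contract]

theorem Circle.one_contract (s : ℝ) : (1 : Circle).contract s = 1 := by simp [Circle.contract]

/-- In the right half plane `arcsin (im z)` is the argument of `z`, so the contraction rotates `z`
back to `1`. -/
theorem Circle.contract_one {z : Circle} (hz : 0 < (z : ℂ).re) : z.contract 1 = 1 := by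
  have h := Complex.arg_of_re_nonneg hz.le
  rw [Circle.norm_coe, div_one] at h
  rw [Circle.contract, one_mul, ← h, Circle.exp_neg, Circle.exp_arg, mul_inv_cancel]

theorem Circle.continuous_contract : Continuous fun p : Circle × ℝ => p.1.contract p.2 := by
  unfold Circle.contract
  have : Continuous fun p : Circle × ℝ => Real.arcsin (p.1 : ℂ).im :=
    Real.continuous_arcsin.comp (Complex.continuous_im.comp
      (continuous_subtype_val.comp continuous_fst))
  fun_prop

theorem Circle.exp_eq_one_iff_int (t : ℝ) :
    Circle.exp (2 * Real.pi * t) = 1 ↔ ∃ n : ℤ, t = n := by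
  rw [Circle.exp_eq_one]
  have := Real.two_pi_pos
  refine exists_congr fun n => ?_
  rw [mul_comm, mul_right_cancel_iff_of_pos this]

end CircleLemmas

/-! ### Flat functions on a wedge of circles. -/

namespace CircleWedge

open scoped unitInterval Topology

variable {α : Type u} {Y : Type*}

theorem ind {P : CircleWedge α → Prop} (h₀ : P base) (h : ∀ a z, P (circle a z)) (x) : P x := by
  obtain ⟨⟨⟩ | ⟨a, z⟩, rfl⟩ := Quot.exists_rep x
  exacts [h₀, h a z]

/-- The map defined on the wedge by a family of maps on the circles. -/
def lift (f : α → Circle → Y) (y : Y) (h : ∀ a, f a 1 = y) : CircleWedge α → Y :=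
  Quot.lift (Sum.elim (fun _ => y) fun p => f p.1 p.2) (by
    rintro _ _ ⟨a⟩
    exact h a)

section

variable {f : α → Circle → Y} {y : Y} {h : ∀ a, f a 1 = y}

@[simp] theorem lift_base : lift f y h base = y := rfl

@[simp] theorem lift_circle (a : α) (z : Circle) : lift f y h (circle a z) = f a z := rfl

end

theorem continuous_iff [TopologicalSpace Y] {f : CircleWedge α → Y} :
    Continuous f ↔ ∀ a, Continuous fun z => f (circle a z) := by
  refine ⟨fun hf a => hf.comp (continuous_circle a), fun hf => ?_⟩
  exact isQuotientMap_quot_mk.continuous_iff.2 (continuous_sum_dom.2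
    ⟨continuous_of_const fun _ _ => rfl, continuous_sigma fun a => hf a⟩)

theorem isOpen_iff {s : Set (CircleWedge α)} : IsOpen s ↔ ∀ a, IsOpen (circle a ⁻¹' s) := by
  rw [isOpen_iff_continuous_mem, continuous_iff]
  exact forall_congr' fun a => isOpen_iff_continuous_mem.symm

/-- The index and the coordinate of a point different from the wedge point. -/
def coord : CircleWedge α → Option (Σ _ : α, Circle) :=
  open Classical in lift (fun a z => if z = 1 then none else some ⟨a, z⟩) none (by simp)

theorem coord_circle (a : α) {z : Circle} (hz : z ≠ 1) : coord (circle a z) = some ⟨a, z⟩ := by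
  simp [coord, hz]

/-- The circle without its base point. -/
abbrev PuncturedCircle : Type := {z : Circle // z ≠ 1}

/-- The inclusion of the disjoint union of the punctured circles. -/
def puncturedCircles (p : Σ _ : α, PuncturedCircle) : CircleWedge α := circle p.1 p.2

/-- Injectivity is read off from `coord`; openness is tested circle by circle. -/
theorem isOpenEmbedding_puncturedCircles :
    Topology.IsOpenEmbedding (puncturedCircles (α := α)) := by
  refine .of_continuous_injective_isOpenMap ?_ ?_ ?_
  · exact continuous_sigma fun a => (continuous_circle a).comp continuous_subtype_val
  · rintro ⟨a, z, hz⟩ ⟨b, z', hz'⟩ h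
    have h' := congrArg coord h
    rw [puncturedCircles, puncturedCircles, coord_circle a hz, coord_circle b hz'] at h'
    simp only [Option.some.injEq, Sigma.mk.injEq, heq_eq_eq] at h'
    obtain ⟨rfl, rfl⟩ := h'
    rfl
  · intro O hO
    rw [isOpen_iff]
    intro b
    have : circle b ⁻¹' (puncturedCircles '' O) =
        (Subtype.val : PuncturedCircle → Circle) '' ((fun z => ⟨b, z⟩) ⁻¹' O) := by
      ext z
      constructor
      · rintro ⟨⟨a, z', hz'⟩, hO', h⟩
        by_cases hz : z = 1
        · have h' := congrArg coord h
          rw [puncturedCircles, coord_circle a hz'] at h'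
          simp [coord, hz] at h'
        · have h' := congrArg coord h
          rw [puncturedCircles, coord_circle a hz', coord_circle b hz] at h'
          simp only [Option.some.injEq, Sigma.mk.injEq, heq_eq_eq] at h'
          obtain ⟨rfl, rfl⟩ := h'
          exact ⟨⟨z', hz'⟩, hO', rfl⟩
      · rintro ⟨⟨z, hz⟩, hO', rfl⟩
        exact ⟨_, hO', rfl⟩
    rw [this]
    exact (isOpen_ne.isOpenEmbedding_subtypeVal.isOpenMap) _ (hO.preimage continuous_sigmaMk)

/-- The real part of the coordinate of a point. -/
def re : CircleWedge α → ℝ := lift (fun _ z => (z : ℂ).re) 1 (by simp)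

theorem re_circle (a : α) (z : Circle) : re (circle a z) = (z : ℂ).re := rfl

theorem continuous_re : Continuous (re : CircleWedge α → ℝ) :=
  continuous_iff.2 fun _ => Complex.continuous_re.comp continuous_subtype_val

/-- The open cover of the wedge by a neighbourhood of the wedge point and its complement. -/
def cover (b : Bool) : Set (CircleWedge α) :=
  if b then {x | 0 < re x} else Set.range puncturedCircles

theorem isOpen_cover : ∀ b, IsOpen (cover b : Set (CircleWedge α))
  | true => isOpen_lt continuous_const continuous_re
  | false => isOpenEmbedding_puncturedCircles.isOpen_range

theorem exists_mem_cover (x : CircleWedge α) : ∃ b, x ∈ cover b := by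
  induction x using ind with
  | h₀ => exact ⟨true, zero_lt_one' ℝ⟩
  | h a z =>
    by_cases hz : z = 1
    · subst hz
      exact ⟨true, by simp [cover, re_circle]⟩
    · exact ⟨false, ⟨a, z, hz⟩, rfl⟩

/-- The parametrization of a circle of the wedge by the real line. -/
def line (a : α) : C(ℝ, CircleWedge α) :=
  ⟨fun t => circle a (Circle.exp (2 * Real.pi * t)), (continuous_circle a).comp (by fun_prop)⟩

theorem line_param (a : α) (z : Circle) : line a z.param = circle a z :=
  congrArg (circle a) z.exp_param

theorem line_comp_segmentPath_zero_one (a : α) :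
    (line a).comp (segmentPath 0 1) = (loop a : C(I, CircleWedge α)) := by
  ext t
  simp [line, loop, segmentPath, AffineMap.lineMap_apply]

/-- The deformation that contracts the neighbourhood of the wedge point to the wedge point. -/
def contract : C(CircleWedge α, C(I, CircleWedge α)) where
  toFun := lift (fun a z => ⟨fun s => circle a (z.contract s), (continuous_circle a).comp
    (Circle.continuous_contract.comp (by fun_prop : Continuous fun s : I => (z, (s : ℝ))))⟩)
    (.const _ base) fun a => by
      ext s
      simp [Circle.one_contract, circle_one]
  continuous_toFun := continuous_iff.2 fun a =>
    (ContinuousMap.curry ⟨fun p : Circle × I => circle a (p.1.contract p.2),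
      (continuous_circle a).comp (Circle.continuous_contract.comp
        (continuous_fst.prodMk (continuous_subtype_val.comp continuous_snd)))⟩).continuous

theorem contract_zero (x : CircleWedge α) : contract x 0 = x := by
  induction x using ind with
  | h₀ => rfl
  | h a z => exact congrArg (circle a) z.contract_zero

theorem contract_one {x : CircleWedge α} (hx : 0 < re x) : contract x 1 = base := by
  induction x using ind with
  | h₀ => rfl
  | h a z => exact (congrArg (circle a) (Circle.contract_one hx)).trans (circle_one a)

variable {H : Type*} [Group H]

/-- There are flat functions on the wedge with prescribed values on the circles. -/
theorem exists_isFlatOn (h : α → H) :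
    ∃ F : C(I, CircleWedge α) → H, IsFlatOn Set.univ F ∧ ∀ a, F (loop a) = h a := by
  classical
  -- The coboundary of this step function picks up `h a` on crossing `-1` downwards. The other jump,
  -- at the wedge point, is suppressed by setting `G` equal to `1` on paths through the wedge point.
  let u : CircleWedge α → H := lift (fun a z => if 0 ≤ (z : ℂ).im then 1 else h a) 1 (by simp)
  let G : C(I, CircleWedge α) → H := fun γ =>
    if ∀ t, γ t ∈ Set.range puncturedCircles then (u (γ 0))⁻¹ * u (γ 1) else 1
  -- A path near the wedge point that avoids it stays in the upper or in the lower half of one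
  -- circle, where `u` is constant. So the two local descriptions of `G` agree on the overlap.
  have hG1 : ∀ γ : C(I, CircleWedge α), (∀ t, 0 < re (γ t)) → G γ = 1 := by
    intro γ hγ
    by_cases hA : ∀ t, γ t ∈ Set.range puncturedCircles
    · obtain ⟨a, g, hg⟩ := exists_lift_of_isEmbedding_sigma (B := fun _ => PuncturedCircle)
        isOpenEmbedding_puncturedCircles.isEmbedding γ hA
      have him := nonneg_iff_of_ne_zero (f := fun t => ((g t : Circle) : ℂ).im)
        (Complex.continuous_im.comp
          ((continuous_subtype_val : Continuous fun z : Circle => (z : ℂ)).comp (by fun_prop))) (fun t ht => by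
          have := hγ t
          rw [hg t] at this
          exact (g t).2 (Circle.eq_one_of_im_eq_zero ht this.le)) 0 1
      have hu : ∀ t, u (γ t) = if 0 ≤ ((g t : Circle) : ℂ).im then 1 else h a := fun t => by
        rw [hg t]; rfl
      rw [show G γ = _ from if_pos hA, hu, hu, if_congr him rfl rfl, inv_mul_cancel]
    · exact if_neg hA
  have hG : ∀ b, IsFlatOn (cover b) G := by
    rintro (_ | _)
    · exact (isFlatOn_coboundary _ u).congr fun γ hγ => if_pos hγ
    · exact (isFlatOn_coboundary _ fun _ => 1).congr fun γ hγ => by simp [hG1 γ hγ]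
  obtain ⟨F, hF, hFG⟩ := exists_isFlatOn_univ isOpen_cover exists_mem_cover hG
  refine ⟨F, hF, fun a => ?_⟩
  obtain ⟨f, hf⟩ := hF.exists_primitive (line a) fun _ => Set.mem_univ _
  have hseg : ∀ (s t : ℝ) (r : I), s ≤ t → s ≤ segmentPath s t r ∧ segmentPath s t r ≤ t := by
    intro s t r hst
    simp only [segmentPath, ContinuousMap.coe_mk, AffineMap.lineMap_apply, vsub_eq_sub,
      smul_eq_mul, vadd_eq_add]
    constructor <;> nlinarith [r.2.1, r.2.2]
  have hre : ∀ t : ℝ, re (line a t) = Real.cos (2 * Real.pi * t) := fun t => by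
    rw [← Complex.exp_ofReal_mul_I_re, ← Circle.coe_exp]; rfl
  have hu : ∀ t : ℝ, u (line a t) = if 0 ≤ Real.sin (2 * Real.pi * t) then 1 else h a :=
    fun t => by
      rw [← Complex.exp_ofReal_mul_I_im, ← Circle.coe_exp]; rfl
  have hpi := Real.pi_pos
  have e (s t : ℝ) : F ((line a).comp (segmentPath s t)) = (f s)⁻¹ * f t := by
    rw [hf]
    simp [segmentPath]
  -- The loop is cut at `1 / 8` and `7 / 8`: the outer pieces lie in the right half circle and
  -- contribute `1`, the middle piece avoids the wedge point and contributes `h a`.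
  have e1 : F ((line a).comp (segmentPath 0 (1 / 8))) = 1 := by
    rw [hFG true _ fun r => ?_, hG1 _ fun r => ?_]
    all_goals
      have := hseg 0 (1 / 8) r (by norm_num)
      refine (hre _).trans_gt (Real.cos_pos_of_mem_Ioo ⟨?_, ?_⟩) <;> nlinarith
  have e2 : F ((line a).comp (segmentPath (7 / 8) 1)) = 1 := by
    rw [hFG true _ fun r => ?_, hG1 _ fun r => ?_]
    all_goals
      have := hseg (7 / 8) 1 r (by norm_num)
      refine (hre _).trans_gt ?_
      rw [← Real.cos_sub_two_pi]
      refine (Real.cos_pos_of_mem_Ioo ⟨?_, ?_⟩) <;> nlinarith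
  have e3 : F ((line a).comp (segmentPath (1 / 8) (7 / 8))) = h a := by
    have hmem : ∀ r, (line a).comp (segmentPath (1 / 8) (7 / 8)) r ∈
        Set.range puncturedCircles := fun r => by
      have := hseg (1 / 8) (7 / 8) r (by norm_num)
      refine ⟨⟨a, _, fun h1 => ?_⟩, rfl⟩
      obtain ⟨n, hn⟩ := (Circle.exp_eq_one_iff_int _).1 h1
      rw [hn] at this
      have h0 : (0 : ℝ) < n := by linarith
      have h1 : (n : ℝ) < 1 := by linarith
      norm_cast at h0 h1
      omega
    rw [hFG false _ hmem]
    simp only [G, if_pos hmem]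
    have s1 : segmentPath (1 / 8 : ℝ) (7 / 8) 0 = 1 / 8 := by simp [segmentPath]
    have s2 : segmentPath (1 / 8 : ℝ) (7 / 8) 1 = 7 / 8 := by simp [segmentPath]
    rw [ContinuousMap.comp_apply, ContinuousMap.comp_apply, s1, s2, hu, hu, if_pos, if_neg]
    · simp
    · rw [not_le, ← Real.sin_sub_two_pi]
      apply Real.sin_neg_of_neg_of_neg_pi_lt <;> linarith
    · apply Real.sin_nonneg_of_nonneg_of_le_pi <;> linarith
  rw [e] at e1 e2 e3
  rw [← line_comp_segmentPath_zero_one, e, inv_mul_eq_one.1 e1, ← inv_mul_eq_one.1 e2, e3]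

/-- The value of a flat function on the loop of a word. -/
theorem map_wordLoop {F : C(I, CircleWedge α) → H} (hF : IsFlatOn Set.univ F)
    (w : List (α × Bool)) :
    F (wordLoop w) = FreeGroup.lift (fun a => F (loop a)) (FreeGroup.mk w) := by
  rw [FreeGroup.lift_mk]
  induction w with
  | nil => exact hF.map_refl base
  | cons x w ih =>
    have hx : F (letterLoop x) = cond x.2 (F (loop x.1)) (F (loop x.1))⁻¹ := by
      obtain ⟨a, _ | _⟩ := x
      · exact hF.map_symm _
      · rfl
    rw [wordLoop, hF.map_trans, ih, hx, List.map_cons, List.prod_cons]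

/-- If the values of a flat function on the circles lie in a subgroup, then so do, after a suitable
twist, its values on all paths. -/
theorem exists_twist_mem {F : C(I, CircleWedge α) → H} (hF : IsFlatOn Set.univ F)
    (S : Subgroup H) (hS : ∀ a : α, F (loop a) ∈ S) :
    ∃ u : CircleWedge α → H, u base = 1 ∧
      ∀ γ : C(I, CircleWedge α), u (γ 0) * F γ * (u (γ 1))⁻¹ ∈ S := by
  -- Normalization at `1` rather than `0`, because `Circle.param` takes values in `(0, 1]` and gives
  -- the base point the parameter `1`.
  have hf : ∀ a, ∃ f, IsPrimitiveAlong F (line a) f ∧ f 1 = 1 := fun a => by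
    obtain ⟨f, hf⟩ := hF.exists_primitive (line a) fun _ => Set.mem_univ _
    exact ⟨_, hf.mul_left (f 1)⁻¹, by simp⟩
  choose f hf hf1 using hf
  have hf0 : ∀ a, f a 0 ∈ S := fun a => by
    have := hS a
    rw [← line_comp_segmentPath_zero_one, hf a] at this
    simpa [segmentPath, hf1] using this
  let u : CircleWedge α → H := lift (fun a z => f a z.param) 1 fun a => by
    rw [Circle.param_one, hf1]
  have hu : ∀ x, 0 < re x → u x * F (contract x) ∈ S := by
    intro x hx
    induction x using ind with
    | h₀ =>
      have : F (contract base) = 1 := hF.map_const (Set.mem_univ base)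
      rw [this]
      simp [u]
    | h a z =>
      -- The contracting track is the image of a segment of the line that ends at an integer.
      have e : (contract (circle a z) : C(I, CircleWedge α)) = (line a).comp
          (segmentPath z.param (z.param - Real.arcsin (z : ℂ).im / (2 * Real.pi))) := by
        ext s
        refine congrArg (circle a) ?_
        have hpi := Real.pi_pos
        have : 2 * Real.pi * segmentPath z.param
            (z.param - Real.arcsin (z : ℂ).im / (2 * Real.pi)) s =
            2 * Real.pi * z.param + -(s * Real.arcsin (z : ℂ).im) := by
          simp only [segmentPath, ContinuousMap.coe_mk, AffineMap.lineMap_apply, vsub_eq_sub,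
            smul_eq_mul, vadd_eq_add]
          field_simp
          ring
        rw [this, Circle.exp_add, z.exp_param]
        rfl
      have hend := contract_one hx
      rw [e] at hend ⊢
      rw [hf a]
      set b := z.param - Real.arcsin (z : ℂ).im / (2 * Real.pi) with hb
      have s1 : segmentPath z.param b 0 = z.param := by simp [segmentPath]
      have s2 : segmentPath z.param b 1 = b := by simp [segmentPath]
      rw [ContinuousMap.comp_apply, s2] at hend
      rw [s1, s2]
      have hb' : f a b ∈ S := by
        have hint : Circle.exp (2 * Real.pi * b) = 1 := by
          by_contra hne
          have := congrArg coord hend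
          erw [coord_circle a hne] at this
          simp [coord] at this
        obtain ⟨n, hn⟩ := (Circle.exp_eq_one_iff_int _).1 hint
        have hpi := Real.pi_pos
        have h1 : Real.arcsin (z : ℂ).im / (2 * Real.pi) ≤ 1 / 4 := by
          rw [div_le_iff₀ (by positivity)]
          linarith [Real.arcsin_le_pi_div_two (z : ℂ).im]
        have h2 : -(1 / 4) ≤ Real.arcsin (z : ℂ).im / (2 * Real.pi) := by
          rw [le_div_iff₀ (by positivity)]
          linarith [Real.neg_pi_div_two_le_arcsin (z : ℂ).im]
        have h3 : ((-1 : ℤ) : ℝ) < n := by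
          push_cast
          linarith [z.param_pos]
        have h4 : (n : ℝ) < (2 : ℤ) := by
          push_cast
          linarith [z.param_le_one]
        norm_cast at h3 h4
        -- The track turns by at most a quarter circle and starts in `(0, 1]`, so it ends at `0` or
        -- `1`, where the primitive takes values in `S`.
        obtain rfl | rfl : n = 0 ∨ n = 1 := by omega
        · rw [hn, Int.cast_zero]
          exact hf0 a
        · rw [hn, Int.cast_one, hf1]
          exact S.one_mem
      simpa [u] using hb'
  refine ⟨u, rfl, hF.mem_subgroup_of_cover isOpen_cover exists_mem_cover S u ?_⟩
  rintro (_ | _) γ hγ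
  · obtain ⟨a, g, hg⟩ := exists_lift_of_isEmbedding_sigma (B := fun _ => PuncturedCircle)
      isOpenEmbedding_puncturedCircles.isEmbedding γ hγ
    -- Away from the wedge point the path lifts continuously to the line, and `u` is the primitive
    -- there, so the twisted value is `1`.
    have e : γ = (line a).comp ⟨fun t => (g t : Circle).param,
        continuous_iff_continuousAt.2 fun t => (Circle.continuousAt_param (g t).2).comp
          (f := fun t => (g t : Circle)) (by fun_prop)⟩ := by
      ext t
      exact (hg t).trans (line_param a _).symm
    have hut : ∀ t, u (γ t) = f a (g t : Circle).param := fun t => by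
      rw [hg t]
      rfl
    rw [hut, hut, e, hf a]
    simp
  · rw [hF.map_eq_of_deformation contract contract_zero γ]
    have : F ⟨fun t => contract (γ t) 1, by fun_prop⟩ = 1 := by
      rw [← hF.map_refl base]
      congr 1
      ext t
      exact contract_one (hγ t)
    rw [this]
    have h := S.mul_mem (hu _ (hγ 0)) (S.inv_mem (hu _ (hγ 1)))
    simpa [mul_assoc] using h

end CircleWedge

/-! ### Loops as maps on the circle. -/

section LoopsOnCircle

open scoped unitInterval Topology

variable {X : Type*} [TopologicalSpace X] {H : Type*} [Group H]

theorem isQuotientMap_unitInterval_circle :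
    Topology.IsQuotientMap fun t : I => Circle.exp (2 * Real.pi * t) := by
  have hc : Continuous fun t : I => Circle.exp (2 * Real.pi * t) := by fun_prop
  exact hc.isClosedMap.isQuotientMap hc fun z =>
    ⟨⟨z.param, z.param_pos.le, z.param_le_one⟩, z.exp_param⟩

theorem Circle.exists_int_param_exp (t : ℝ) :
    ∃ n : ℤ, (Circle.exp (2 * Real.pi * t)).param = t + n := by
  obtain ⟨n, hn⟩ := (Circle.exp_eq_one_iff_int
    ((Circle.exp (2 * Real.pi * t)).param - t)).1 (by
      rw [mul_sub, Circle.exp_sub, Circle.exp_param, div_self'])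
  exact ⟨n, by rw [← hn]; ring⟩

/-- The value at `exp (2πit)` of a loop, regarded as a map on the circle, is its value at `t`. -/
theorem Path.apply_param_exp {x : X} (γ : Path x x) (t : I) :
    γ ⟨(Circle.exp (2 * Real.pi * t)).param, (Circle.param_pos _).le, Circle.param_le_one _⟩ =
      γ t := by
  obtain ⟨n, hn⟩ := Circle.exists_int_param_exp t
  have h1 := (Circle.exp (2 * Real.pi * (t : ℝ))).param_pos
  have h2 := (Circle.exp (2 * Real.pi * (t : ℝ))).param_le_one
  have h3 : ((-1 : ℤ) : ℝ) < n := by push_cast; linarith [t.2.2]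
  have h4 : (n : ℝ) < (2 : ℤ) := by push_cast; linarith [t.2.1]
  norm_cast at h3 h4
  -- The case `n = 1` occurs only for `t = 0`, since `param` is `1` at the base point; there the
  -- loop closes up.
  obtain rfl | rfl : n = 0 ∨ n = 1 := by omega
  · congr 1
    ext
    simpa using hn
  · push_cast at hn
    have ht : t = 0 := Subtype.ext (by simpa using le_antisymm (by linarith) t.2.1)
    subst ht
    rw [γ.source]
    convert γ.target
    exact Subtype.ext (by simpa using hn)

/-- A loop as a map on the circle. -/
def Path.onCircle {x : X} (γ : Path x x) : C(Circle, X) where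
  toFun z := γ ⟨z.param, z.param_pos.le, z.param_le_one⟩
  continuous_toFun := isQuotientMap_unitInterval_circle.continuous_iff.2
    (γ.continuous.congr fun t => (γ.apply_param_exp t).symm)

theorem Path.onCircle_exp {x : X} (γ : Path x x) (t : I) :
    γ.onCircle (Circle.exp (2 * Real.pi * t)) = γ t :=
  γ.apply_param_exp t

/-- A flat function that is trivial on a loop has a primitive along the loop. -/
theorem IsFlatOn.exists_primitive_onCircle {F : C(I, X) → H} (hF : IsFlatOn Set.univ F) {x : X}
    (γ : Path x x) (hγ : F γ = 1) : ∃ v, IsPrimitiveAlong F γ.onCircle v := by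
  let e : C(ℝ, Circle) := ⟨fun t => Circle.exp (2 * Real.pi * t), by fun_prop⟩
  obtain ⟨f, hf⟩ := hF.exists_primitive (γ.onCircle.comp e) fun _ => Set.mem_univ _
  have h01 : f 0 = f 1 := by
    have h := hf (segmentPath 0 1)
    have hc : (γ.onCircle.comp e).comp (segmentPath 0 1) = (γ : C(I, X)) := by
      ext t
      refine Eq.trans ?_ (γ.onCircle_exp t)
      simp [e, segmentPath, AffineMap.lineMap_apply]
    rw [hc, hγ] at h
    exact inv_mul_eq_one.1 (by simpa [segmentPath] using h.symm)
  -- Translating a segment by `1` does not change its image path, and `f 0 = f 1` by triviality on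
  -- the loop; so `f` descends to the circle.
  have hper : Function.Periodic f 1 := by
    intro t
    have h := hf (segmentPath 0 t)
    have h' := hf (segmentPath 1 (t + 1))
    have hc : (γ.onCircle.comp e).comp (segmentPath 1 (t + 1)) =
        (γ.onCircle.comp e).comp (segmentPath 0 t) := by
      ext s
      refine congrArg γ.onCircle ?_
      have : 2 * Real.pi * segmentPath 1 (t + 1) s =
          2 * Real.pi * segmentPath 0 t s + 2 * Real.pi := by
        simp only [segmentPath, ContinuousMap.coe_mk, AffineMap.lineMap_apply, vsub_eq_sub,
          smul_eq_mul, vadd_eq_add]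
        ring
      simp only [e, ContinuousMap.coe_mk]
      rw [this, Circle.exp_add, Circle.exp_two_pi, mul_one]
    rw [hc, h] at h'
    simpa [segmentPath, h01] using h'.symm
  refine ⟨fun z => f z.param, fun p => ?_⟩
  have hpi := Real.two_pi_pos
  -- A path in the circle is lifted through the covering `Circle.exp`, and the increment of `f`
  -- along the lift is the value sought.
  obtain ⟨q, hq, -⟩ := Circle.isCoveringMap_exp.exists_path_lifts p (2 * Real.pi * (p 0).param)
    (p 0).exp_param.symm
  have hfq : ∀ t, f ((p t).param) = f (q t / (2 * Real.pi)) := fun t => by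
    have hqt : p t = Circle.exp (2 * Real.pi * (q t / (2 * Real.pi))) := by
      rw [mul_div_cancel₀ _ hpi.ne']
      exact (congrFun hq t).symm
    obtain ⟨n, hn⟩ := Circle.exists_int_param_exp (q t / (2 * Real.pi))
    rw [← hqt] at hn
    rw [hn]
    simpa using hper.int_mul n (q t / (2 * Real.pi))
  have hc : γ.onCircle.comp p = (γ.onCircle.comp e).comp
      ⟨fun t => q t / (2 * Real.pi), by fun_prop⟩ := by
    ext t
    refine congrArg γ.onCircle ?_
    simp only [e, ContinuousMap.coe_mk]
    rw [mul_div_cancel₀ _ hpi.ne']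
    exact (congrFun hq t).symm
  dsimp only
  rw [hc, hf, hfq, hfq]
  rfl

end LoopsOnCircle

/-! ### Polar coordinates and the radial deformation of the disc. -/

namespace ClosedDisc

open scoped unitInterval Topology

instance contractibleSpace : ContractibleSpace ClosedDisc :=
  (convex_closedBall _ _).contractibleSpace ⟨0, by simp⟩

/-- A point of the disc as a complex number. -/
def toComplex (y : ClosedDisc) : ℂ := ⟨y.1 0, y.1 1⟩

theorem norm_toComplex (y : ClosedDisc) : ‖toComplex y‖ = ‖y.1‖ := by
  rw [EuclideanSpace.norm_eq, Complex.norm_eq_sqrt_sq_add_sq]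
  simp [toComplex, Fin.sum_univ_two]

theorem continuous_toComplex : Continuous toComplex := by
  have h : toComplex = fun y : ClosedDisc => ((y.1 0 : ℝ) : ℂ) + ((y.1 1 : ℝ) : ℂ) * Complex.I := by
    ext y
    exact Complex.ext (by simp [toComplex]) (by simp [toComplex])
  rw [h]
  fun_prop

/-- The direction of a point of the disc (the direction `1` for the centre). -/
def dir (y : ClosedDisc) : Circle := Circle.exp (Complex.arg (toComplex y))

theorem coe_dir {y : ClosedDisc} (hy : y.1 ≠ 0) : (dir y : ℂ) = toComplex y / ‖y.1‖ := by
  have h := Complex.norm_mul_exp_arg_mul_I (toComplex y)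
  rw [norm_toComplex] at h
  have hn : ((‖y.1‖ : ℝ) : ℂ) ≠ 0 := by exact_mod_cast norm_ne_zero_iff.2 hy
  rw [dir, Circle.coe_exp, eq_div_iff hn, mul_comm, h]

theorem continuousOn_dir : ContinuousOn dir {y | y.1 ≠ 0} := by
  have hi : Topology.IsInducing (fun z : Circle => (z : ℂ)) := ⟨rfl⟩
  rw [hi.continuousOn_iff]
  have h : ContinuousOn (fun y : ClosedDisc => toComplex y / (‖y.1‖ : ℝ)) {y | y.1 ≠ 0} := by
    refine ContinuousOn.div continuous_toComplex.continuousOn (by fun_prop) fun y hy => ?_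
    exact_mod_cast norm_ne_zero_iff.2 hy
  exact h.congr fun y hy => coe_dir hy

theorem norm_boundaryPoint (t : I) : ‖(boundaryPoint t).1‖ = 1 := by
  simp [boundaryPoint, EuclideanSpace.norm_eq, Fin.sum_univ_two]

theorem continuous_boundaryPoint : Continuous boundaryPoint := by
  unfold boundaryPoint
  fun_prop

theorem ne_zero_of_norm_pos {y : ClosedDisc} (hy : 0 < ‖y.1‖) : y.1 ≠ 0 := norm_pos_iff.1 hy

theorem toComplex_boundaryPoint (t : I) :
    toComplex (boundaryPoint t) = Circle.exp (2 * Real.pi * t) := by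
  rw [Circle.coe_exp]
  apply Complex.ext
  · rw [Complex.exp_ofReal_mul_I_re]
    simp [toComplex, boundaryPoint]
  · rw [Complex.exp_ofReal_mul_I_im]
    simp [toComplex, boundaryPoint]

theorem dir_boundaryPoint (t : I) : dir (boundaryPoint t) = Circle.exp (2 * Real.pi * t) := by
  ext
  rw [coe_dir (ne_zero_of_norm_pos (by simp [norm_boundaryPoint])), norm_boundaryPoint,
    toComplex_boundaryPoint]
  simp

theorem toComplex_injective : Function.Injective toComplex := by
  intro y y' h
  ext i
  fin_cases i
  · exact congrArg Complex.re h
  · exact congrArg Complex.im h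

theorem eq_boundaryPoint {y : ClosedDisc} (hy : ‖y.1‖ = 1) :
    y = boundaryPoint ⟨(dir y).param, (Circle.param_pos _).le, Circle.param_le_one _⟩ := by
  apply toComplex_injective
  rw [toComplex_boundaryPoint, Circle.exp_param,
    coe_dir (ne_zero_of_norm_pos (by simp [hy])), hy]
  simp

/-- The radial deformation of the disc that pushes the points of norm at least `1 / 2` to the
boundary and fixes the boundary. -/
def stretch (y : ClosedDisc) (s : I) : ClosedDisc :=
  ⟨((1 + s : ℝ) / max 1 ((1 + s) * ‖y.1‖)) • y.1, by
    have h1 : (0 : ℝ) < 1 + s := by linarith [s.2.1]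
    have h2 : (0 : ℝ) < max 1 ((1 + s) * ‖y.1‖) := lt_max_of_lt_left one_pos
    rw [mem_closedBall_zero_iff, norm_smul, Real.norm_of_nonneg (by positivity), div_mul_eq_mul_div,
      div_le_one h2]
    exact le_max_right _ _⟩

theorem continuous_stretch : Continuous fun p : ClosedDisc × I => stretch p.1 p.2 := by
  refine Continuous.subtype_mk ?_ _
  have h1 : Continuous fun p : ClosedDisc × I => (1 + p.2 : ℝ) := by fun_prop
  have h2 : Continuous fun p : ClosedDisc × I => p.1.1 := by fun_prop
  exact (h1.div (continuous_const.max (h1.mul h2.norm))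
    fun p => (lt_max_of_lt_left one_pos).ne').smul h2

theorem stretch_zero (y : ClosedDisc) : stretch y 0 = y := by
  have h : ‖y.1‖ ≤ 1 := mem_closedBall_zero_iff.1 y.2
  ext1
  simp [stretch, h]

theorem stretch_of_norm_eq_one {y : ClosedDisc} (hy : ‖y.1‖ = 1) (s : I) : stretch y s = y := by
  have h1 : (1 : ℝ) ≤ 1 + s := by linarith [s.2.1]
  ext1
  simp only [stretch, hy, mul_one, max_eq_right h1]
  rw [div_self (by linarith), one_smul]

theorem norm_stretch_one {y : ClosedDisc} (hy : 1 / 2 ≤ ‖y.1‖) : ‖(stretch y 1).1‖ = 1 := by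
  have h : (1 : ℝ) ≤ (1 + 1) * ‖y.1‖ := by linarith
  have h0 : (0 : ℝ) < (1 + 1) * ‖y.1‖ := by linarith
  simp only [stretch, Set.Icc.coe_one, max_eq_right h]
  rw [norm_smul, Real.norm_of_nonneg (by positivity), div_mul_eq_mul_div, div_self h0.ne']

theorem dir_stretch (y : ClosedDisc) (s : I) : dir (stretch y s) = dir y := by
  have h1 : (0 : ℝ) < 1 + s := by linarith [s.2.1]
  have h2 : (0 : ℝ) < max 1 ((1 + s) * ‖y.1‖) := lt_max_of_lt_left one_pos
  have h : toComplex (stretch y s) =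
      (((1 + s : ℝ) / max 1 ((1 + s) * ‖y.1‖) : ℝ) : ℂ) * toComplex y :=
    Complex.ext (by simp only [Complex.re_ofReal_mul]; rfl)
      (by simp only [Complex.im_ofReal_mul]; rfl)
  rw [dir, h, Complex.arg_real_mul _ (by positivity), dir]

end ClosedDisc

/-! ### Flat functions on the presentation complex. -/

namespace PresentationComplex

open scoped unitInterval Topology

variable {α ι : Type u} {w : ι → List (α × Bool)} {Y : Type*}

theorem ofDisc_boundaryPoint (i : ι) (t : I) :
    ofDisc w i (boundaryPoint t) = ofWedge w (CircleWedge.wordLoop (w i) t) :=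
  Quot.sound (Rel.glue i t)

theorem ind {P : PresentationComplex w → Prop} (h₁ : ∀ x, P (ofWedge w x))
    (h₂ : ∀ i y, P (ofDisc w i y)) (x) : P x := by
  obtain ⟨x | ⟨i, y⟩, rfl⟩ := Quot.exists_rep x
  exacts [h₁ x, h₂ i y]

/-- The map defined on the presentation complex by a map on the wedge of circles and a family of
maps on the discs. -/
def lift (f : CircleWedge α → Y) (g : ι → ClosedDisc → Y)
    (h : ∀ i t, g i (boundaryPoint t) = f (CircleWedge.wordLoop (w i) t)) :
    PresentationComplex w → Y :=
  Quot.lift (Sum.elim f fun p => g p.1 p.2) (by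
    rintro _ _ ⟨i, t⟩
    exact h i t)

theorem continuous_iff [TopologicalSpace Y] {f : PresentationComplex w → Y} :
    Continuous f ↔ (Continuous fun x => f (ofWedge w x)) ∧
      ∀ i, Continuous fun y => f (ofDisc w i y) := by
  refine (isQuotientMap_quot_mk (r := Rel w)).continuous_iff.trans ?_
  rw [continuous_sum_dom, continuous_sigma_iff]
  rfl

theorem isOpen_iff {s : Set (PresentationComplex w)} :
    IsOpen s ↔ IsOpen (ofWedge w ⁻¹' s) ∧ ∀ i, IsOpen (ofDisc w i ⁻¹' s) := by
  simp only [isOpen_iff_continuous_mem, continuous_iff]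
  rfl

theorem continuous_ofWedge : Continuous (ofWedge w) :=
  (continuous_iff.1 continuous_id).1

theorem continuous_ofDisc (i : ι) : Continuous (ofDisc w i) :=
  (continuous_iff.1 continuous_id).2 i

/-- The attaching map of a disc. -/
def attach (w : ι → List (α × Bool)) (i : ι) : C(Circle, CircleWedge α) :=
  (CircleWedge.wordLoop (w i)).onCircle

theorem attach_dir_boundaryPoint (i : ι) (t : I) :
    attach w i (ClosedDisc.dir (boundaryPoint t)) = CircleWedge.wordLoop (w i) t := by
  rw [ClosedDisc.dir_boundaryPoint, attach, Path.onCircle_exp]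

theorem ofDisc_of_norm_eq_one (i : ι) {y : ClosedDisc} (hy : ‖y.1‖ = 1) :
    ofDisc w i y = ofWedge w (attach w i (ClosedDisc.dir y)) := by
  conv_lhs => rw [ClosedDisc.eq_boundaryPoint hy, ofDisc_boundaryPoint]
  rfl

/-- The norm of the coordinate of a point. -/
def radius : PresentationComplex w → ℝ :=
  lift (fun _ => 1) (fun _ y => ‖y.1‖) fun _ t => ClosedDisc.norm_boundaryPoint t

theorem continuous_radius : Continuous (radius : PresentationComplex w → ℝ) :=
  continuous_iff.2 ⟨continuous_const, fun _ => continuous_norm.comp continuous_subtype_val⟩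

/-- The index and the coordinate of a point in the interior of a disc. -/
def coord : PresentationComplex w → Option (Σ _ : ι, ClosedDisc) :=
  open Classical in lift (fun _ => none)
    (fun i y => if ‖y.1‖ < 1 then some ⟨i, y⟩ else none) fun _ t => by
      simp [ClosedDisc.norm_boundaryPoint]

theorem coord_ofWedge (x : CircleWedge α) : coord (ofWedge w x) = none := rfl

theorem coord_ofDisc (i : ι) {y : ClosedDisc} (hy : ‖y.1‖ < 1) :
    coord (ofDisc w i y) = some ⟨i, y⟩ :=
  if_pos hy

theorem coord_ofDisc_of_not_lt (i : ι) {y : ClosedDisc} (hy : ¬ ‖y.1‖ < 1) :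
    coord (ofDisc w i y) = none :=
  if_neg hy

/-- The open disc. -/
abbrev OpenDisc : Type := {y : ClosedDisc // ‖y.1‖ < 1}

/-- The inclusion of the disjoint union of the open discs. -/
def openDiscs (w : ι → List (α × Bool)) (p : Σ _ : ι, OpenDisc) : PresentationComplex w :=
  ofDisc w p.1 p.2

theorem isOpenEmbedding_openDiscs : Topology.IsOpenEmbedding (openDiscs w) := by
  refine .of_continuous_injective_isOpenMap ?_ ?_ ?_
  · exact continuous_sigma fun i => (continuous_ofDisc i).comp continuous_subtype_val
  · rintro ⟨i, y, hy⟩ ⟨j, y', hy'⟩ h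
    have h' := congrArg coord h
    rw [openDiscs, openDiscs, coord_ofDisc i hy, coord_ofDisc j hy'] at h'
    simp only [Option.some.injEq, Sigma.mk.injEq, heq_eq_eq] at h'
    obtain ⟨rfl, rfl⟩ := h'
    rfl
  · intro O hO
    rw [isOpen_iff]
    refine ⟨?_, fun j => ?_⟩
    · convert isOpen_empty
      ext x
      refine iff_of_false ?_ id
      rintro ⟨⟨i, y, hy⟩, -, h⟩
      have h' := congrArg coord h
      rw [openDiscs, coord_ofDisc i hy, coord_ofWedge] at h'
      cases h'
    · have : ofDisc w j ⁻¹' (openDiscs w '' O) =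
          (Subtype.val : OpenDisc → ClosedDisc) '' ((fun y => ⟨j, y⟩) ⁻¹' O) := by
        ext y
        constructor
        · rintro ⟨⟨i, y', hy'⟩, hO', h⟩
          have h' := congrArg coord h
          by_cases hy : ‖y.1‖ < 1
          · rw [openDiscs, coord_ofDisc i hy', coord_ofDisc j hy] at h'
            simp only [Option.some.injEq, Sigma.mk.injEq, heq_eq_eq] at h'
            obtain ⟨rfl, rfl⟩ := h'
            exact ⟨⟨y', hy'⟩, hO', rfl⟩
          · rw [openDiscs, coord_ofDisc i hy', coord_ofDisc_of_not_lt j hy] at h'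
            cases h'
        · rintro ⟨⟨y, hy⟩, hO', rfl⟩
          exact ⟨_, hO', rfl⟩
      rw [this]
      have hop : IsOpen {y : ClosedDisc | ‖y.1‖ < 1} :=
        isOpen_lt (continuous_norm.comp continuous_subtype_val) continuous_const
      exact hop.isOpenEmbedding_subtypeVal.isOpenMap _ (hO.preimage continuous_sigmaMk)

/-- The open cover of the complex by a neighbourhood of the wedge and the union of the open
discs. -/
def cover (w : ι → List (α × Bool)) (b : Bool) : Set (PresentationComplex w) :=
  if b then {x | 1 / 2 < radius x} else Set.range (openDiscs w)

theorem isOpen_cover : ∀ b, IsOpen (cover w b)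
  | true => isOpen_lt continuous_const continuous_radius
  | false => isOpenEmbedding_openDiscs.isOpen_range

theorem ofWedge_mem_cover (x : CircleWedge α) : ofWedge w x ∈ cover w true := by
  change (1 / 2 : ℝ) < 1
  norm_num

theorem exists_mem_cover (x : PresentationComplex w) : ∃ b, x ∈ cover w b := by
  induction x using ind with
  | h₁ x => exact ⟨true, ofWedge_mem_cover x⟩
  | h₂ i y =>
    by_cases hy : ‖y.1‖ < 1
    · exact ⟨false, ⟨i, y, hy⟩, rfl⟩
    · exact ⟨true, lt_of_lt_of_le (by norm_num) (not_lt.1 hy)⟩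

/-- The radial projection to the wedge. -/
def retract : PresentationComplex w → CircleWedge α :=
  lift id (fun i y => attach w i (ClosedDisc.dir y)) attach_dir_boundaryPoint

@[simp] theorem retract_ofWedge (x : CircleWedge α) : retract (ofWedge w x) = x := rfl

/-- The direction is continuous away from the centres, which the cover set omits. As that set is
open, continuity can be tested before passing to the quotient. -/
theorem continuousOn_retract : ContinuousOn (retract (w := w)) (cover w true) := by
  have hq : Topology.IsQuotientMap (Quot.mk (Rel w) : _ → PresentationComplex w) :=
    isQuotientMap_quot_mk
  refine (hq.continuousOn_isOpen_iff (isOpen_cover true)).2 ?_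
  refine ((isOpen_cover true).preimage hq.continuous).continuousOn_iff.2 ?_
  rintro (x | ⟨i, y⟩) hx
  · exact Topology.IsOpenEmbedding.inl.continuousAt_iff.1 continuousAt_id
  · refine (Topology.IsOpenEmbedding.inr.comp
      (Topology.IsOpenEmbedding.sigmaMk (i := i))).continuousAt_iff.1 ?_
    refine (attach w i).continuous.continuousAt.comp
      (ClosedDisc.continuousOn_dir.continuousAt (IsOpen.mem_nhds ?_ ?_))
    · exact isOpen_ne.preimage continuous_subtype_val
    · exact ClosedDisc.ne_zero_of_norm_pos (lt_trans (by norm_num) hx)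

/-- The deformation that pushes a neighbourhood of the wedge to the wedge. -/
def deformation : C(PresentationComplex w, C(I, PresentationComplex w)) where
  toFun := lift (fun x => .const _ (ofWedge w x))
    (fun i y => ⟨fun s => ofDisc w i (y.stretch s), (continuous_ofDisc i).comp
      (ClosedDisc.continuous_stretch.comp (by fun_prop : Continuous fun s : I => (y, s)))⟩)
    fun i t => by
      ext s
      exact (congrArg _ (ClosedDisc.stretch_of_norm_eq_one
        (ClosedDisc.norm_boundaryPoint t) s)).trans (ofDisc_boundaryPoint i t)
  continuous_toFun := continuous_iff.2
    ⟨(ContinuousMap.curry ⟨fun p : CircleWedge α × I => ofWedge w p.1,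
      continuous_ofWedge.comp continuous_fst⟩).continuous, fun i =>
    (ContinuousMap.curry ⟨fun p : ClosedDisc × I => ofDisc w i (p.1.stretch p.2),
      (continuous_ofDisc i).comp ClosedDisc.continuous_stretch⟩).continuous⟩

theorem deformation_ofWedge (x : CircleWedge α) :
    deformation (ofWedge w x) = .const _ (ofWedge w x) := rfl

theorem deformation_zero (x : PresentationComplex w) : deformation x 0 = x := by
  induction x using ind with
  | h₁ x => rfl
  | h₂ i y => exact congrArg (ofDisc w i) y.stretch_zero

theorem deformation_one {x : PresentationComplex w} (hx : x ∈ cover w true) :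
    deformation x 1 = ofWedge w (retract x) := by
  induction x using ind with
  | h₁ x => rfl
  | h₂ i y =>
    refine (ofDisc_of_norm_eq_one i (ClosedDisc.norm_stretch_one (le_of_lt hx))).trans ?_
    rw [ClosedDisc.dir_stretch]
    rfl

/-- The projection to the wedge of a path in the neighbourhood of the wedge. -/
def retractMap {T : Type*} [TopologicalSpace T] (γ : C(T, PresentationComplex w))
    (hγ : ∀ t, γ t ∈ cover w true) : C(T, CircleWedge α) :=
  ⟨fun t => retract (γ t), continuousOn_retract.comp_continuous γ.continuous hγ⟩

variable {H : Type*} [Group H]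

/-- A flat function on the wedge that is trivial on the loops of the relators extends to the
complex. -/
theorem exists_isFlatOn {F : C(I, CircleWedge α) → H} (hF : IsFlatOn Set.univ F)
    (hw : ∀ i, F (CircleWedge.wordLoop (w i)) = 1) :
    ∃ F' : C(I, PresentationComplex w) → H, IsFlatOn Set.univ F' ∧
      ∀ γ : C(I, CircleWedge α), F' ((⟨ofWedge w, continuous_ofWedge⟩ : C(_, _)).comp γ) = F γ := by
  classical
  -- Triviality on the relator loop provides a primitive on the boundary circle of each disc.
  -- Extended along the radii it makes `F` of the projected path a coboundary on the punctured open
  -- disc, so the two definitions of `G` agree on the overlap.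
  choose v hv using fun i => hF.exists_primitive_onCircle _ (hw i)
  let u : PresentationComplex w → H := fun x =>
    (coord x).elim 1 fun p => v p.1 (ClosedDisc.dir p.2)
  let G : C(I, PresentationComplex w) → H := fun γ =>
    if hγ : ∀ t, γ t ∈ cover w true then F (retractMap γ hγ) else (u (γ 0))⁻¹ * u (γ 1)
  have hG1 : ∀ (γ : C(I, PresentationComplex w)) (hγ : ∀ t, γ t ∈ cover w true),
      G γ = F (retractMap γ hγ) := fun γ hγ => dif_pos hγ
  have hG : ∀ b, IsFlatOn (cover w b) G := by
    rintro (_ | _)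
    · refine (isFlatOn_coboundary _ u).congr fun γ hγ => ?_
      by_cases h : ∀ t, γ t ∈ cover w true
      · rw [hG1 γ h]
        obtain ⟨i, g, hg⟩ := exists_lift_of_isEmbedding_sigma (B := fun _ => OpenDisc)
          isOpenEmbedding_openDiscs.isEmbedding γ hγ
        have hne : ∀ t, (g t : ClosedDisc).1 ≠ 0 := fun t => by
          have ht := h t
          rw [hg t] at ht
          exact ClosedDisc.ne_zero_of_norm_pos (lt_trans (by norm_num) ht)
        have e : retractMap γ h = (attach w i).comp ⟨fun t => ClosedDisc.dir (g t),
            ClosedDisc.continuousOn_dir.comp_continuous (by fun_prop) hne⟩ := by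
          ext t
          change retract (γ t) = _
          rw [hg t]
          rfl
        have hu : ∀ t, u (γ t) = v i (ClosedDisc.dir (g t)) := fun t => by
          simp only [u]
          rw [hg t, openDiscs, coord_ofDisc i (g t).2]
          rfl
        rw [e, attach, hv i, hu, hu]
        rfl
      · exact dif_neg h
    · intro K hK
      obtain ⟨f, hf⟩ := hF (retractMap K hK) fun _ => Set.mem_univ _
      exact ⟨f, fun p => (hG1 _ fun t => hK (p t)).trans (hf p)⟩
  obtain ⟨F', hF', hFG⟩ := exists_isFlatOn_univ isOpen_cover exists_mem_cover hG
  refine ⟨F', hF', fun γ => ?_⟩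
  have hγ : ∀ t, ((⟨ofWedge w, continuous_ofWedge⟩ : C(_, _)).comp γ) t ∈ cover w true :=
    fun t => ofWedge_mem_cover (γ t)
  rw [hFG true _ hγ, hG1 _ hγ]
  rfl

/-- The loops of the relators are trivial for every flat function on the complex. -/
theorem map_wordLoop_eq_one {F : C(I, PresentationComplex w) → H} (hF : IsFlatOn Set.univ F)
    (i : ι) : F ((⟨ofWedge w, continuous_ofWedge⟩ : C(_, _)).comp
      (CircleWedge.wordLoop (w i) : C(I, CircleWedge α))) = 1 := by
  obtain ⟨f, hf⟩ := hF.exists_primitive ⟨ofDisc w i, continuous_ofDisc i⟩ fun _ => Set.mem_univ _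
  have h := hf ⟨boundaryPoint, ClosedDisc.continuous_boundaryPoint⟩
  have e : (⟨ofDisc w i, continuous_ofDisc i⟩ : C(_, _)).comp
      ⟨boundaryPoint, ClosedDisc.continuous_boundaryPoint⟩ =
      (⟨ofWedge w, continuous_ofWedge⟩ : C(_, _)).comp
        (CircleWedge.wordLoop (w i) : C(I, CircleWedge α)) := by
    ext t
    exact ofDisc_boundaryPoint i t
  -- The boundary path of the disc closes up, so a primitive on the disc has increment `1` along it.
  have hb : boundaryPoint 0 = boundaryPoint 1 := by
    apply ClosedDisc.toComplex_injective
    simp [ClosedDisc.toComplex_boundaryPoint]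
  rw [e] at h
  rw [h, ContinuousMap.coe_mk, hb, inv_mul_cancel]

/-- If the values of a flat function on the circles lie in a subgroup, then so do its values on all
loops at the wedge point. -/
theorem map_loop_mem {F : C(I, PresentationComplex w) → H} (hF : IsFlatOn Set.univ F)
    (S : Subgroup H)
    (hS : ∀ a : α, F ((⟨ofWedge w, continuous_ofWedge⟩ : C(_, _)).comp
      (CircleWedge.loop a : C(I, CircleWedge α))) ∈ S)
    (γ : Path (ofWedge w CircleWedge.base) (ofWedge w CircleWedge.base)) : F γ ∈ S := by
  classical
  let j : C(CircleWedge α, PresentationComplex w) := ⟨ofWedge w, continuous_ofWedge⟩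
  obtain ⟨u₁, hu₁, hu₁S⟩ := CircleWedge.exists_twist_mem (hF.comp j) S hS
  have hf : ∀ i, ∃ f, IsPrimitiveAlong F ⟨ofDisc w i, continuous_ofDisc i⟩ f ∧
      f (boundaryPoint 0) = 1 := fun i => by
    obtain ⟨f, hf⟩ := hF.exists_primitive ⟨ofDisc w i, continuous_ofDisc i⟩
      fun _ => Set.mem_univ _
    exact ⟨_, hf.mul_left (f (boundaryPoint 0))⁻¹, by simp⟩
  choose f hf hf1 using hf
  -- On the boundary, the primitive on the disc and the twist on the wedge agree modulo `S`: both
  -- start at `1`, and the initial piece of the relator loop up to `t` compares them.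
  have hfb : ∀ i t, f i (boundaryPoint t) * (u₁ (CircleWedge.wordLoop (w i) t))⁻¹ ∈ S := by
    intro i t
    let q : C(I, I) := ⟨fun s => s * t, by fun_prop⟩
    have h := hf i ⟨fun s => boundaryPoint (q s),
      ClosedDisc.continuous_boundaryPoint.comp q.continuous⟩
    have e : (⟨ofDisc w i, continuous_ofDisc i⟩ : C(_, _)).comp
        ⟨fun s => boundaryPoint (q s), ClosedDisc.continuous_boundaryPoint.comp q.continuous⟩ =
        j.comp ((CircleWedge.wordLoop (w i) : C(I, CircleWedge α)).comp q) := by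
      ext s
      exact ofDisc_boundaryPoint i (q s)
    have h' := hu₁S ((CircleWedge.wordLoop (w i) : C(I, CircleWedge α)).comp q)
    rw [← e, h] at h'
    simpa [q, hf1, hu₁] using h'
  let u : PresentationComplex w → H := lift u₁
    (fun i y => if ‖y.1‖ < 1 then f i y else u₁ (attach w i (ClosedDisc.dir y))) fun i t => by
      rw [if_neg (by simp [ClosedDisc.norm_boundaryPoint]), attach_dir_boundaryPoint]
  have hu : ∀ i (y : OpenDisc), u (ofDisc w i y) = f i y := fun i y => if_pos y.2
  -- Pushing a point of the collar radially to the boundary turns the twist of the disc into that of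
  -- the wedge modulo `S`.
  have hcollar : ∀ x, x ∈ cover w true → u x * F (deformation x) * (u₁ (retract x))⁻¹ ∈ S := by
    have hW : ∀ x, u (ofWedge w x) * F (deformation (ofWedge w x)) *
        (u₁ (retract (ofWedge w x)))⁻¹ ∈ S := fun x => by
      rw [deformation_ofWedge, hF.map_const (Set.mem_univ _), retract_ofWedge]
      simp [show u (ofWedge w x) = u₁ x from rfl]
    intro x hx
    induction x using ind with
    | h₁ x => exact hW x
    | h₂ i y =>
      by_cases hy : ‖y.1‖ < 1
      · have h := hf i ⟨fun s => y.stretch s, ClosedDisc.continuous_stretch.comp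
          (by fun_prop : Continuous fun s : I => (y, s))⟩
        have hb := ClosedDisc.eq_boundaryPoint (ClosedDisc.norm_stretch_one (le_of_lt hx))
        have hd : F (deformation (ofDisc w i y)) = (f i y)⁻¹ * f i (y.stretch 1) := by
          refine h.trans ?_
          simp [ClosedDisc.stretch_zero]
        have hr : retract (ofDisc w i y) = CircleWedge.wordLoop (w i)
            ⟨(ClosedDisc.dir (y.stretch 1)).param, (Circle.param_pos _).le,
              Circle.param_le_one _⟩ := by
          change attach w i (ClosedDisc.dir y) = _
          rw [← ClosedDisc.dir_stretch y 1]
          rfl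
        rw [hu i ⟨y, hy⟩, hd, mul_inv_cancel_left, hr, hb]
        convert hfb i _ using 5
        rw [← hb]
      · have h1 : ‖y.1‖ = 1 :=
          le_antisymm (mem_closedBall_zero_iff.1 y.2) (not_lt.1 hy)
        rw [ofDisc_of_norm_eq_one i h1]
        exact hW _
  have key := hF.mem_subgroup_of_cover isOpen_cover exists_mem_cover S u (by
    rintro (_ | _) γ hγ
    · obtain ⟨i, g, hg⟩ := exists_lift_of_isEmbedding_sigma (B := fun _ => OpenDisc)
        isOpenEmbedding_openDiscs.isEmbedding γ hγ
      have e : γ = (⟨ofDisc w i, continuous_ofDisc i⟩ : C(_, _)).comp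
          ⟨fun t => (g t : ClosedDisc), by fun_prop⟩ := by
        ext t
        exact hg t
      have hut : ∀ t, u (γ t) = f i (g t) := fun t => by
        rw [hg t]
        exact hu i (g t)
      rw [hut, hut, e, hf i]
      simp
    · rw [hF.map_eq_of_deformation deformation deformation_zero γ]
      have e : (⟨fun t => deformation (γ t) 1, by fun_prop⟩ : C(I, PresentationComplex w)) =
          j.comp (retractMap γ hγ) := by
        ext t
        exact deformation_one (hγ t)
      rw [e]
      have h := S.mul_mem (S.mul_mem (hcollar _ (hγ 0)) (hu₁S (retractMap γ hγ)))
        (S.inv_mem (hcollar _ (hγ 1)))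
      simpa [mul_assoc, retractMap] using h) γ
  have h1 : u (ofWedge w CircleWedge.base) = 1 := hu₁
  simpa [h1] using key

end PresentationComplex

/-! ### The fundamental group of the presentation complex. -/

namespace PresentationComplex

open scoped unitInterval Topology

variable {α ι : Type u} (w : ι → List (α × Bool))

instance pathConnectedSpace : PathConnectedSpace (PresentationComplex w) := by
  have hW : ∀ x : CircleWedge α, Joined CircleWedge.base x := by
    intro x
    induction x using CircleWedge.ind with
    | h₀ => exact Joined.refl _
    | h a z =>
      have h := (PathConnectedSpace.joined (0 : ℝ) z.param).map (CircleWedge.line a).continuous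
      rwa [CircleWedge.line_param, show CircleWedge.line a 0 = CircleWedge.base by
        simp [CircleWedge.line, CircleWedge.circle_one]] at h
  have hX : ∀ x : PresentationComplex w, Joined (ofWedge w CircleWedge.base) x := by
    intro x
    induction x using ind with
    | h₁ x => exact (hW x).map continuous_ofWedge
    | h₂ i y =>
      have h := (PathConnectedSpace.joined (boundaryPoint 0) y).map (continuous_ofDisc (w := w) i)
      rw [ofDisc_boundaryPoint] at h
      exact ((hW _).map continuous_ofWedge).trans h
  exact ⟨⟨ofWedge w CircleWedge.base⟩, fun x y => (hX x).symm.trans (hX y)⟩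

/-- The tautological flat function `F` is trivial on relators and so defines `Φ`. The flat function
with values in the presented group that sends each circle to its generator extends over the discs
and defines a left inverse `Ψ`. Every loop has its value in the range of `Φ` because the circles do.
-/
theorem nonempty_presentedGroup_mulEquiv :
    Nonempty (PresentedGroup (Set.range fun i => FreeGroup.mk (w i)) ≃*
      FundamentalGroup (PresentationComplex w) (ofWedge w CircleWedge.base)) := by
  let j : C(CircleWedge α, PresentationComplex w) := ⟨ofWedge w, continuous_ofWedge⟩
  obtain ⟨F, hF, hFγ⟩ := exists_isFlatOn_fundamentalGroup (ofWedge w CircleWedge.base)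
  let f : α → FundamentalGroup (PresentationComplex w) (ofWedge w CircleWedge.base) :=
    fun a => F (j.comp (CircleWedge.loop a : C(I, CircleWedge α)))
  have hrel : ∀ r ∈ Set.range fun i => FreeGroup.mk (w i), FreeGroup.lift f r = 1 := by
    rintro _ ⟨i, rfl⟩
    exact (CircleWedge.map_wordLoop (hF.comp j) (w i)).symm.trans (map_wordLoop_eq_one hF i)
  let Φ := PresentedGroup.toGroup hrel
  obtain ⟨F₁, hF₁, hF₁a⟩ := CircleWedge.exists_isFlatOn
    (fun a => (PresentedGroup.of a : PresentedGroup (Set.range fun i => FreeGroup.mk (w i))))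
  have hF₁w : ∀ i, F₁ (CircleWedge.wordLoop (w i)) = 1 := fun i => by
    rw [CircleWedge.map_wordLoop hF₁]
    simp only [hF₁a]
    have h : FreeGroup.lift (fun a => (PresentedGroup.of a :
        PresentedGroup (Set.range fun i => FreeGroup.mk (w i)))) = PresentedGroup.mk _ := by
      ext a
      simp [PresentedGroup.of]
    rw [h]
    exact PresentedGroup.one_of_mem ⟨i, rfl⟩
  obtain ⟨F₂, hF₂, hF₂γ⟩ := exists_isFlatOn hF₁ hF₁w
  let Ψ := hF₂.fundamentalGroupHom (ofWedge w CircleWedge.base)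
  -- The inverse in the normalization of `F` cancels the one in `fundamentalGroupHom`.
  have hΨ : ∀ γ : Path (ofWedge w CircleWedge.base) (ofWedge w CircleWedge.base),
      Ψ (F γ) = F₂ γ := fun γ => by
    rw [hFγ, map_inv]
    exact inv_inv _
  have hΨΦ : Ψ.comp Φ = MonoidHom.id _ := by
    ext a
    rw [MonoidHom.comp_apply, PresentedGroup.toGroup.of]
    exact (hΨ ((CircleWedge.loop a).map continuous_ofWedge)).trans
      ((hF₂γ (CircleWedge.loop a)).trans (hF₁a a))
  refine ⟨MulEquiv.ofBijective Φ ⟨Function.LeftInverse.injective (g := Ψ)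
    (DFunLike.congr_fun hΨΦ), fun g => ?_⟩⟩
  induction g using Quotient.inductionOn with | _ γ =>
  have h := map_loop_mem hF Φ.range (fun a =>
    ⟨PresentedGroup.of a, PresentedGroup.toGroup.of hrel⟩) γ
  rw [hFγ, inv_mem_iff] at h
  exact h

theorem nonempty_fundamentalGroup_mulEquiv {G : Type u} [Group G] (hw : Presents w G)
    (x : PresentationComplex w) :
    Nonempty (FundamentalGroup (PresentationComplex w) x ≃* G) := by
  obtain ⟨e⟩ := hw
  obtain ⟨e'⟩ := nonempty_presentedGroup_mulEquiv w
  exact ⟨((FundamentalGroup.fundamentalGroupMulEquivOfPathConnected _ _).trans e'.symm).trans e⟩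

end PresentationComplex

/-- Every group has a presentation with a nonempty family of relators. -/
theorem exists_presents (G : Type u) [Group G] :
    ∃ (α ι : Type u) (w : ι → List (α × Bool)), Nonempty ι ∧ Presents w G := by
  classical
  let π : FreeGroup G →* G := FreeGroup.lift id
  -- All elements are generators and all elements of the kernel are relators; the trivial one makes
  -- the family nonempty.
  refine ⟨G, π.ker, fun r => r.1.toWord, ⟨1⟩, ?_⟩
  have hr : (Set.range fun r : π.ker => FreeGroup.mk r.1.toWord) = π.ker := by
    ext r
    simp [FreeGroup.mk_toWord]
  rw [Presents, hr]
  refine ⟨(QuotientGroup.quotientMulEquivOfEq (Subgroup.normalClosure_eq_self _)).trans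
    (QuotientGroup.quotientKerEquivOfSurjective π fun g => ⟨FreeGroup.of g, by simp [π]⟩)⟩

/-! ### Attaching cells through a universal property. -/

section AttachCells

open Limits HomotopicalAlgebra

/-- Constructor for attaching cells from attaching maps, characteristic maps and the universal
property of a space obtained by attaching cells. -/
def HomotopicalAlgebra.AttachCells.ofUniversalProperty {C : Type*} [Category C]
    {A B X₁ X₂ : C} (i : A ⟶ B) (f : X₁ ⟶ X₂) {κ : Type u}
    [HasCoproduct fun _ : κ => A] [HasCoproduct fun _ : κ => B]
    (b : κ → (A ⟶ X₁)) (c : κ → (B ⟶ X₂)) (comm : ∀ k, b k ≫ f = i ≫ c k)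
    (univ : ∀ (Z : C) (p : X₁ ⟶ Z) (q : κ → (B ⟶ Z)), (∀ k, b k ≫ p = i ≫ q k) →
      ∃! d : X₂ ⟶ Z, f ≫ d = p ∧ ∀ k, c k ≫ d = q k) :
    AttachCells (fun _ : Unit => i) f where
  ι := κ
  π _ := ()
  cofan₁ := Cofan.mk (∐ fun _ : κ => A) (Limits.Sigma.ι _)
  cofan₂ := Cofan.mk (∐ fun _ : κ => B) (Limits.Sigma.ι _)
  isColimit₁ := coproductIsCoproduct _
  isColimit₂ := coproductIsCoproduct _
  m := Limits.Sigma.map fun _ => i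
  hm k := Limits.Sigma.ι_map _ k
  g₁ := Limits.Sigma.desc b
  g₂ := Limits.Sigma.desc c
  isPushout := by
    have w : Limits.Sigma.desc b ≫ f = Limits.Sigma.map (fun _ => i) ≫ Limits.Sigma.desc c :=
      Limits.Sigma.hom_ext _ _ fun k => by simp [comm]
    have hs : ∀ s : PushoutCocone (Limits.Sigma.desc b) (Limits.Sigma.map fun _ : κ => i),
        ∀ k, b k ≫ s.inl = i ≫ Limits.Sigma.ι (fun _ : κ => B) k ≫ s.inr := fun s k => by
      have := Limits.Sigma.ι (fun _ : κ => A) k ≫= s.condition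
      simpa using this
    choose d hd hd' using fun s : PushoutCocone (Limits.Sigma.desc b)
        (Limits.Sigma.map fun _ : κ => i) =>
      univ s.pt s.inl (fun k => Limits.Sigma.ι (fun _ : κ => B) k ≫ s.inr) (hs s)
    refine IsPushout.of_isColimit' ⟨w⟩ (PushoutCocone.IsColimit.mk _ d (fun s => (hd s).1)
      (fun s => Limits.Sigma.hom_ext _ _ fun k => ?_) fun s m h₁ h₂ => hd' s m ⟨h₁, fun k => ?_⟩)
    · rw [Limits.Sigma.ι_desc_assoc]
      exact (hd s).2 k
    · rw [← h₂, Limits.Sigma.ι_desc_assoc]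

/-- Transport of the attachment of cells along an equality of morphisms. -/
def HomotopicalAlgebra.AttachCells.ofEq {C : Type*} [Category C] {T : Type*} {A B : T → C}
    {g : ∀ a, A a ⟶ B a} {X₁ X₂ : C} {f f' : X₁ ⟶ X₂} (c : AttachCells.{u} g f) (h : f = f') :
    AttachCells.{u} g f' :=
  { c with isPushout := h ▸ c.isPushout }

end AttachCells

/-! ### The CW-structure of the presentation complex. -/

namespace PresentationComplex

open Limits HomotopicalAlgebra TopCat
open scoped unitInterval

variable {α ι : Type u} (w : ι → List (α × Bool))

theorem diskBoundaryInclusion_down {n : ℕ} (x : ∂𝔻 n) :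
    (diskBoundaryInclusion n x).down.1 = x.down.1 := by
  obtain ⟨x⟩ := x
  rfl

theorem norm_diskBoundaryInclusion {n : ℕ} (x : ∂𝔻 n) :
    ‖(diskBoundaryInclusion n x).down.1‖ = 1 :=
  (congrArg norm (diskBoundaryInclusion_down x)).trans (mem_sphere_zero_iff_norm.1 x.down.2)

/-- The terms of the skeletal filtration: the empty space, a point, the wedge of circles, and from
then on the whole complex. -/
def stage : ℕ → TopCat.{u}
  | 0 => TopCat.of PEmpty
  | 1 => TopCat.of PUnit
  | 2 => TopCat.of (CircleWedge α)
  | _ + 3 => TopCat.of (PresentationComplex w)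

/-- The maps of the skeletal filtration. -/
def stageMap : ∀ n, stage w n ⟶ stage w (n + 1)
  | 0 => isInitialPEmpty.to _
  | 1 => ofHom (.const PUnit CircleWedge.base)
  | 2 => ofHom ⟨ofWedge w, continuous_ofWedge⟩
  | _ + 3 => 𝟙 _

/-- The maps from the skeletal filtration to the complex. -/
def stageIncl : ∀ n, stage w n ⟶ TopCat.of (PresentationComplex w)
  | 0 => isInitialPEmpty.to _
  | 1 => ofHom (.const PUnit (ofWedge w CircleWedge.base))
  | 2 => ofHom ⟨ofWedge w, continuous_ofWedge⟩
  | _ + 3 => 𝟙 _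

theorem stageMap_stageIncl : ∀ n, stageMap w n ≫ stageIncl w (n + 1) = stageIncl w n
  | 0 => isInitialPEmpty.hom_ext _ _
  | 1 => rfl
  | 2 => rfl
  | _ + 3 => rfl

/-- The `0`-cell. -/
def attachPoint : AttachCells.{u} (RelativeCWComplex.basicCell 0) (stageMap w 0) :=
  -- The unit sphere of the zero-dimensional space is empty, so attaching a `0`-cell adds a point.
  have : IsEmpty (∂𝔻 0 : TopCat.{u}) := ⟨fun x => by
    have h := mem_sphere_zero_iff_norm.1 x.down.2
    rw [Subsingleton.elim x.down.1 0, norm_zero] at h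
    exact zero_ne_one h⟩
  .ofUniversalProperty (κ := PUnit.{u + 1}) _ _ (fun _ => ofHom ⟨isEmptyElim, by fun_prop⟩)
    (fun _ => ofHom (.const _ PUnit.unit)) (fun _ => by ext x; exact isEmptyElim x)
    fun Z p q _ => by
      have hsub : Subsingleton (𝔻 0 : TopCat.{u}) :=
        ⟨fun x y => by
          obtain ⟨x⟩ := x
          obtain ⟨y⟩ := y
          exact congrArg ULift.up (Subsingleton.elim x y)⟩
      let o : (𝔻 0 : TopCat.{u}) := ⟨⟨0, by simp⟩⟩
      refine ⟨ofHom (.const PUnit (q PUnit.unit o)), ⟨isInitialPEmpty.hom_ext _ _, fun k => ?_⟩,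
        fun d hd => ?_⟩
      · ext x
        rw [Subsingleton.elim x o]
        rfl
      · ext x
        rw [← hd.2 PUnit.unit]
        rfl

theorem disk_one_mem (x : (𝔻 1 : TopCat.{u})) : (x.down.1 0 + 1) / 2 ∈ Set.Icc (0 : ℝ) 1 := by
  have h : ‖x.down.1‖ ≤ 1 := mem_closedBall_zero_iff.1 x.down.2
  have h' := abs_le.1 ((PiLp.norm_apply_le x.down.1 0).trans h)
  constructor <;> linarith [h'.1, h'.2]

theorem mem_closedBall_of_mem_unitInterval (t : I) :
    (!₂[2 * (t : ℝ) - 1] : EuclideanSpace ℝ (Fin 1)) ∈ Metric.closedBall 0 1 := by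
  rw [mem_closedBall_zero_iff, EuclideanSpace.norm_eq]
  simp only [Fin.isValue, Finset.univ_unique, Fin.default_eq_zero, Finset.sum_singleton,
    Real.norm_eq_abs, sq_abs, Real.sqrt_sq_eq_abs, Matrix.cons_val_fin_one]
  exact abs_le.2 ⟨by linarith [t.2.1], by linarith [t.2.2]⟩

/-- The `1`-disc, parametrized by the unit interval. -/
def intervalToDisk : C(I, (𝔻 1 : TopCat.{u})) :=
  ⟨fun t => ⟨⟨!₂[2 * (t : ℝ) - 1], mem_closedBall_of_mem_unitInterval t⟩⟩,
    continuous_uliftUp.comp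
      (Continuous.subtype_mk (by fun_prop) mem_closedBall_of_mem_unitInterval)⟩

theorem intervalToDisk_apply (x : (𝔻 1 : TopCat.{u})) :
    intervalToDisk ⟨(x.down.1 0 + 1) / 2, disk_one_mem x⟩ = x := by
  obtain ⟨x⟩ := x
  refine congrArg ULift.up (Subtype.ext ?_)
  ext i
  rw [Subsingleton.elim i 0]
  change 2 * ((x.1 0 + 1) / 2) - 1 = x.1 0
  ring

/-- The characteristic map of a `1`-cell. -/
def circleCell (a : α) : 𝔻 1 ⟶ TopCat.of (CircleWedge α) :=
  ofHom ⟨fun x => CircleWedge.circle a (Circle.exp (Real.pi * (x.down.1 0 + 1))),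
    (CircleWedge.continuous_circle a).comp (by
      have : Continuous fun x : (𝔻 1 : TopCat.{u}) => x.down.1 0 :=
        ((EuclideanSpace.proj (0 : Fin 1)).continuous (R₁ := ℝ)).comp
          (continuous_subtype_val.comp continuous_uliftDown)
      fun_prop)⟩

theorem abs_eq_one_of_mem_diskBoundary (x : (∂𝔻 1 : TopCat.{u})) :
    x.down.1 0 = 1 ∨ x.down.1 0 = -1 := by
  have h := mem_sphere_zero_iff_norm.1 x.down.2
  rw [EuclideanSpace.norm_eq] at h
  simp only [Fin.isValue, Finset.univ_unique, Fin.default_eq_zero, Finset.sum_singleton,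
    Real.norm_eq_abs, sq_abs, Real.sqrt_sq_eq_abs] at h
  exact eq_or_eq_neg_of_abs_eq h

theorem circleCell_boundary (a : α) (x : (∂𝔻 1 : TopCat.{u})) :
    circleCell a (diskBoundaryInclusion 1 x) = CircleWedge.base := by
  have h : Circle.exp (Real.pi * ((diskBoundaryInclusion 1 x).down.1 0 + 1)) = 1 := by
    rw [diskBoundaryInclusion_down]
    obtain h | h := abs_eq_one_of_mem_diskBoundary x
    · rw [h, show Real.pi * (1 + 1) = 2 * Real.pi by ring, Circle.exp_two_pi]
    · simp [h]
  exact (congrArg (CircleWedge.circle a) h).trans (CircleWedge.circle_one a)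

/-- The `1`-cells. -/
def attachCircles : AttachCells.{u} (RelativeCWComplex.basicCell 1) (stageMap w 1) :=
  .ofUniversalProperty (κ := α) _ _ (fun _ => ofHom (.const _ PUnit.unit)) circleCell
    (fun a => by
      ext x
      exact (circleCell_boundary a x).symm)
    fun Z p q h => by
      let e : ∀ s : ℝ, (s = 1 ∨ s = -1) → (∂𝔻 1 : TopCat.{u}) := fun s hs =>
        ⟨⟨!₂[s], by
          rw [mem_sphere_zero_iff_norm, EuclideanSpace.norm_eq]
          obtain rfl | rfl := hs <;> simp⟩⟩
      have hq : ∀ a (t : I) (ht : 2 * (t : ℝ) - 1 = 1 ∨ 2 * (t : ℝ) - 1 = -1),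
          q a (intervalToDisk t) = p PUnit.unit := fun a t ht =>
        (ConcreteCategory.congr_hom (h a) (e _ ht)).symm
      -- A map on the `1`-disc that identifies the two ends is a loop, and `Path.onCircle` makes it
      -- a map on the circle.
      let γ : ∀ _ : α, Path (p PUnit.unit) (p PUnit.unit) := fun a =>
        { toFun := fun t => q a (intervalToDisk t)
          continuous_toFun := (q a).hom.continuous.comp intervalToDisk.continuous
          source' := hq a 0 (by norm_num)
          target' := hq a 1 (by norm_num) }
      have hγ : ∀ a x, (γ a).onCircle (Circle.exp (Real.pi * (x.down.1 0 + 1))) = q a x := by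
        intro a x
        have h1 := (γ a).onCircle_exp ⟨(x.down.1 0 + 1) / 2, disk_one_mem x⟩
        rw [show 2 * Real.pi * ((x.down.1 0 + 1) / 2) = Real.pi * (x.down.1 0 + 1) by ring] at h1
        rw [h1]
        exact congrArg (q a) (intervalToDisk_apply x)
      refine ⟨ofHom ⟨CircleWedge.lift (fun a => (γ a).onCircle) (p PUnit.unit) fun a => ?_,
        CircleWedge.continuous_iff.2 fun a => (γ a).onCircle.continuous⟩,
        ⟨?_, fun a => ?_⟩, fun d hd => ?_⟩
      · have h1 := (γ a).onCircle_exp 0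
        rw [(γ a).source] at h1
        simpa using h1
      · ext x
        rfl
      · ext x
        exact hγ a x
      · ext x
        induction x using CircleWedge.ind with
        | h₀ => exact ConcreteCategory.congr_hom hd.1 PUnit.unit
        | h a z =>
          have h1 := ConcreteCategory.congr_hom (hd.2 a)
            (intervalToDisk ⟨z.param, z.param_pos.le, z.param_le_one⟩)
          refine Eq.trans (congrArg d ?_) h1
          refine congrArg (CircleWedge.circle a) ?_
          change z = Circle.exp (Real.pi * (2 * z.param - 1 + 1))
          rw [show Real.pi * (2 * z.param - 1 + 1) = 2 * Real.pi * z.param by ring, z.exp_param]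

/-- The `2`-cells. -/
def attachDiscs : AttachCells.{u} (RelativeCWComplex.basicCell 2) (stageMap w 2) :=
  .ofUniversalProperty (κ := ι) _ _
    (fun i => ofHom ⟨fun x => attach w i (ClosedDisc.dir (diskBoundaryInclusion 2 x).down),
      (attach w i).continuous.comp (ClosedDisc.continuousOn_dir.comp_continuous
        (continuous_uliftDown.comp (diskBoundaryInclusion 2).hom.continuous) fun x =>
          ClosedDisc.ne_zero_of_norm_pos (one_pos.trans_eq (norm_diskBoundaryInclusion x).symm))⟩)
    (fun i => ofHom ⟨fun x => ofDisc w i x.down,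
      (continuous_ofDisc i).comp continuous_uliftDown⟩)
    (fun i => by
      ext x
      exact (ofDisc_of_norm_eq_one i (norm_diskBoundaryInclusion x)).symm)
    fun Z p q h => by
      let e : I → (∂𝔻 2 : TopCat.{u}) := fun t =>
        ⟨⟨(boundaryPoint t).1, mem_sphere_zero_iff_norm.2 (ClosedDisc.norm_boundaryPoint t)⟩⟩
      refine ⟨ofHom ⟨lift p (fun i y => q i ⟨y⟩) fun i t => ?_,
        continuous_iff.2 ⟨p.hom.continuous, fun i =>
          (q i).hom.continuous.comp continuous_uliftUp⟩⟩, ⟨rfl, fun i => rfl⟩, fun d hd => ?_⟩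
      · exact (ConcreteCategory.congr_hom (h i) (e t)).symm.trans
          (congrArg p (attach_dir_boundaryPoint i t))
      · ext x
        induction x using ind with
        | h₁ x => exact ConcreteCategory.congr_hom hd.1 x
        | h₂ i y => exact ConcreteCategory.congr_hom (hd.2 i) ⟨y⟩

/-- The cells attached at the different stages. -/
def attachStage : ∀ n, AttachCells.{u} (RelativeCWComplex.basicCell n) (stageMap w n)
  | 0 => attachPoint w
  | 1 => attachCircles w
  | 2 => attachDiscs w
  | n + 3 => .ofUniversalProperty (κ := PEmpty.{u + 1}) _ (𝟙 _) (fun k => k.elim)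
      (fun k => k.elim) (fun k => k.elim) fun _ p _ _ =>
        ⟨p, ⟨Category.id_comp _, fun k => k.elim⟩, fun d hd => by
          rw [← hd.1, Category.id_comp]⟩

/-- The inclusion of the skeletal filtration into the complex, as a natural transformation. -/
def stageInclNatTrans : Functor.ofSequence (stageMap w) ⟶
    (Functor.const _).obj (TopCat.of (PresentationComplex w)) :=
  NatTrans.ofSequence (stageIncl w) fun n =>
    ((congrArg (· ≫ stageIncl w (n + 1)) (Functor.ofSequence_map_homOfLE_succ (stageMap w) n)).trans
      (stageMap_stageIncl w n)).trans (Category.comp_id _).symm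

/-- The complex is the colimit of its skeletal filtration. -/
def isColimitStageIncl : IsColimit (Cocone.mk _ (stageInclNatTrans w)) where
  -- The filtration is stationary from stage `3` on.
  desc s := s.ι.app 3
  fac s := by
    have hs : ∀ n, stageMap w n ≫ s.ι.app (n + 1) = s.ι.app n := fun n =>
      (congrArg (· ≫ s.ι.app (n + 1))
        (Functor.ofSequence_map_homOfLE_succ (stageMap w) n).symm).trans (s.w _)
    have h3 : ∀ n, stageIncl w (n + 3) ≫ s.ι.app 3 = s.ι.app (n + 3) := fun n => by
      induction n with
      | zero => exact Category.id_comp _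
      | succ n ih => exact ih.trans ((hs (n + 3)).symm.trans (Category.id_comp _))
    have hstep : ∀ n, stageIncl w (n + 1) ≫ s.ι.app 3 = s.ι.app (n + 1) →
        stageIncl w n ≫ s.ι.app 3 = s.ι.app n := fun n h =>
      (((congrArg (· ≫ s.ι.app 3) (stageMap_stageIncl w n).symm).trans
        (Category.assoc _ _ _)).trans (congrArg (stageMap w n ≫ ·) h)).trans (hs n)
    rintro (_ | _ | _ | n)
    · exact hstep 0 (hstep 1 (hstep 2 (h3 0)))
    · exact hstep 1 (hstep 2 (h3 0))
    · exact hstep 2 (h3 0)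
    · exact h3 n
  uniq s m h := by
    rw [← h 3]
    exact (Category.id_comp _).symm

/-- The standard CW-structure of a presentation complex. -/
def standardCW : TopCat.CWComplex (TopCat.of (PresentationComplex w)) where
  F := Functor.ofSequence (stageMap w)
  isoBot := initialIsoPEmpty.symm
  incl := stageInclNatTrans w
  isColimit := isColimitStageIncl w
  fac := initialIsInitial.hom_ext _ _
  attachCells n _ := (attachStage w n).ofEq (Functor.ofSequence_map_homOfLE_succ _ n).symm

theorem isStandardCW_standardCW : IsStandardCW w (standardCW w) := by
  -- Stage `0` is empty, so the `1`-skeleton is `stage w 2`, the wedge itself, and the identity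
  -- homeomorphism serves.
  refine ⟨⟨Equiv.equivPUnit PUnit⟩, fun k x => ?_, ⟨Equiv.refl α, fun k x => ?_⟩,
    ⟨Equiv.refl ι, fun k x => ?_⟩, fun n hn => ?_, ⟨Homeomorph.refl (CircleWedge α), fun x => rfl⟩⟩
  · rfl
  · have h : (attachCircles w).cell k = circleCell k := Limits.Sigma.ι_desc _ _
    exact congrArg (ofWedge w) (ConcreteCategory.congr_hom h x)
  · have h : (attachDiscs w).cell k =
        ofHom ⟨fun x : (𝔻 2 : TopCat.{u}) => ofDisc w k x.down,
          (continuous_ofDisc k).comp continuous_uliftDown⟩ := Limits.Sigma.ι_desc _ _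
    exact ConcreteCategory.congr_hom h x
  · obtain ⟨n, rfl⟩ := Nat.exists_eq_add_of_lt hn
    rw [show 2 + n + 1 = n + 3 by omega]
    exact inferInstanceAs (IsEmpty PEmpty)

end PresentationComplex

end

theorem mainTheorem10 (G : Type u) [Group G] :
    (∃ (X : TopCat.{u}) (c : TopCat.CWComplex X), c.HasDimension 2 ∧ PathConnectedSpace X ∧
      ∀ x : X, Nonempty (FundamentalGroup X x ≃* G)) ∧
    (∃ (α ι : Type u) (w : ι → List (α × Bool)), Nonempty ι ∧ Presents w G) ∧
    (∀ (α ι : Type u) (w : ι → List (α × Bool)), Presents w G →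
      (∃ c : TopCat.CWComplex (TopCat.of (PresentationComplex w)),
        PresentationComplex.IsStandardCW w c) ∧
      PathConnectedSpace (PresentationComplex w) ∧
      ∀ x : PresentationComplex w, Nonempty (FundamentalGroup (PresentationComplex w) x ≃* G)) := by
  refine ⟨?_, exists_presents G, fun α ι w hw =>
    ⟨⟨_, PresentationComplex.isStandardCW_standardCW w⟩, PresentationComplex.pathConnectedSpace w,
      PresentationComplex.nonempty_fundamentalGroup_mulEquiv w hw⟩⟩
  -- A relator is needed for the complex to have a `2`-cell, hence dimension exactly `2`.
  obtain ⟨α, ι, w, ⟨i⟩, hw⟩ := exists_presents G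
  obtain ⟨-, -, -, ⟨e₂, -⟩, hn, -⟩ := PresentationComplex.isStandardCW_standardCW w
  exact ⟨TopCat.of (PresentationComplex w), PresentationComplex.standardCW w, ⟨⟨e₂.symm i⟩, hn⟩,
    PresentationComplex.pathConnectedSpace w,
    PresentationComplex.nonempty_fundamentalGroup_mulEquiv w hw⟩
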